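/- Write $C_n$ for the cyclic group of order $n$ and $C_2^{\,m}$ for the direct product of $m$ copies of $C_2$; commutators are $[g,h]=g^{-1}h^{-1}gh$, and longer ones are left-normed, $[g,h,l]=[[g,h],l]$. Let $F_2$ be the free pro-$2$ group on $a,b$. For an integer $k\ge 1$ let $W_k=C_2\wr C_{2^k}=B_k\rtimes\langle \dot x_k\rangle$ be the wreath product, where $\dot x_k$ generates the top group $C_{2^k}$ and the base group $B_k\cong C_2^{\,2^k}$ is the direct product of the groups $\langle \dot y_k^{\,\dot x_k^{\,i}}\rangle\cong C_2$ for $0\le i<2^k$. Let $R_k$ be the kernel of the continuous epimorphism $F_2\to W_k$ with $a\mapsto\dot x_k$, $b\mapsto\dot y_k$, and let $Y_k$ be the preimage of $B_k$. Put $$N_k=[R_k,Y_k]\,R_k^{\,2}\,\langle a^{2^k}\rangle^{F_2},\qquad G_k=F_2/N_k$$ (closed subgroups are meant throughout; $R_k^{\,2}$ is the closed subgroup generated by the squares of elements of $R_k$, and $\langle a^{2^k}\rangle^{F_2}$ is the closed normal closure), and let $x,y$ be the images of $a,b$ in $G_k$. For $i,j\ge 1$ put $c_i=[y,x,\overset{i-1}{\ldots},x]$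 (so $c_1=y$) and $c_{i,j}=[c_i,y,x,\overset{j-1}{\ldots},x]$. Let $\gamma_1(G_k)=G_k$, $\gamma_{i+1}(G_k)=[\gamma_i(G_k),G_k]$ be the lower central series. Then for every integer $k\ge 1$ the group $G_k$ is nilpotent of class exactly $2^{k+1}-1$, and the following hold. 1. $\gamma_1(G_k)=G_k=\langle x,y\rangle\gamma_2(G_k)$ and $\gamma_1(G_k)/\gamma_2(G_k)\cong C_{2^k}\times C_4$. 2. If $2\le i\le 2^k$, then $$\gamma_i(G_k)=\begin{cases}\langle c_i,\ c_{2,i-2},\ c_{4,i-4},\ldots,c_{i-2,2}\rangle\,\gamma_{i+1}(G_k)& i \text{ even},\\ \langle c_i,\ c_{2,i-2},\ c_{4,i-4},\ldots,c_{i-1,1}\rangle\,\gamma_{i+1}(G_k)& i\text{ odd},\end{cases}$$ and $$\gamma_i(G_k)/\gamma_{i+1}(G_k)\cong\begin{cases}C_4\times C_2^{\,(i-2)/2}& 2\le i\le 2^{k-1},\ i\text{ even},\\ C_4\times C_2^{\,(i-1)/2}& 2\le i\le 2^{k-1},\ i\text{ odd},\\ C_2^{\,i/2}& 2^{k-1}+1\le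 i\le 2^k,\ i\text{ even},\\ C_2^{\,(i+1)/2}& 2^{k-1}+1\le i\le 2^k,\ i\text{ odd}.\end{cases}$$ 3. If $2^k+1\le i\le 2^k+2^{k-1}$, then $$\gamma_i(G_k)=\begin{cases}\langle c_i,\ c_{i-2^k+2,\,2^k-2},\ c_{i-2^k+4,\,2^k-4},\ldots,c_{2^k,\,i-2^k}\rangle\,\gamma_{i+1}(G_k)& i\text{ even},\\ \langle c_i,\ c_{i-2^k+1,\,2^k-1},\ c_{i-2^k+3,\,2^k-3},\ldots,c_{2^k,\,i-2^k}\rangle\,\gamma_{i+1}(G_k)& i\text{ odd},\end{cases}$$ and $$\gamma_i(G_k)/\gamma_{i+1}(G_k)\cong\begin{cases}C_2^{\,(2^{k+1}-i+2)/2}& i\text{ even},\\ C_2^{\,(2^{k+1}-i+3)/2}& i\text{ odd}.\end{cases}$$ 4. If $2^k+2^{k-1}+1\le i\le 2^{k+1}$, then $$\gamma_i(G_k)=\begin{cases}\langle c_{i-2^k+2,\,2^k-2},\ c_{i-2^k+4,\,2^k-4},\ldots,c_{2^k,\,i-2^k}\rangle\,\gamma_{i+1}(G_k)& i\text{ even},\\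 \langle c_{i-2^k+1,\,2^k-1},\ c_{i-2^k+3,\,2^k-3},\ldots,c_{2^k,\,i-2^k}\rangle\,\gamma_{i+1}(G_k)& i\text{ odd},\end{cases}$$ and $$\gamma_i(G_k)/\gamma_{i+1}(G_k)\cong\begin{cases}C_2^{\,(2^{k+1}-i)/2}& i\text{ even},\\ C_2^{\,(2^{k+1}-i+1)/2}& i\text{ odd}.\end{cases}$$ In each displayed list of generators, the elements $c_{m,n}$ are those with $m$ even, $m+n=i$ and $m$ running in steps of $2$ from the first to the last displayed value; the list of $c_{m,n}$ is empty if the first value exceeds the last (as for $i=2$ in part 2 and $i=2^{k+1}$ in part 4). -/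

import Mathlib

noncomputable section

namespace WreathCover

/-! ### Pro-2 completions and the free pro-2 group of rank two -/

section Completion

variable (Γ : Type) [Group Γ]

/-- The normal subgroups of `Γ` whose index is a (finite) power of `2`. -/
structure TwoPowerNormal where
  toSubgroup : Subgroup Γ
  normal : toSubgroup.Normal
  index_eq : ∃ n : ℕ, toSubgroup.index = 2 ^ n

instance (U : TwoPowerNormal Γ) : U.toSubgroup.Normal := U.normal

variable {Γ}

/-- The finite `2`-group `Γ / U`, regarded as a discrete group. -/
def FinQuot (U : TwoPowerNormal Γ) : Type := Γ ⧸ U.toSubgroup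

instance (U : TwoPowerNormal Γ) : Group (FinQuot U) :=
  inferInstanceAs (Group (Γ ⧸ U.toSubgroup))

instance (U : TwoPowerNormal Γ) : TopologicalSpace (FinQuot U) := ⊥

instance (U : TwoPowerNormal Γ) : DiscreteTopology (FinQuot U) := ⟨rfl⟩

/-- The projection `Γ → Γ / U`. -/
def toFinQuot (U : TwoPowerNormal Γ) : Γ →* FinQuot U := QuotientGroup.mk' U.toSubgroup

/-- The natural map `Γ / U → Γ / V` for `U ≤ V`. -/
def transition {U V : TwoPowerNormal Γ} (h : U.toSubgroup ≤ V.toSubgroup) :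
    FinQuot U →* FinQuot V :=
  QuotientGroup.map U.toSubgroup V.toSubgroup (MonoidHom.id Γ) h

variable (Γ)

/-- The inverse limit of the finite `2`-quotients of `Γ`, inside their product. -/
def compatibleFamilies : Subgroup (∀ U : TwoPowerNormal Γ, FinQuot U) where
  carrier := {f | ∀ (U V : TwoPowerNormal Γ) (h : U.toSubgroup ≤ V.toSubgroup),
    transition h (f U) = f V}
  mul_mem' := by
    intro f g hf hg U V h
    rw [Pi.mul_apply, Pi.mul_apply, map_mul, hf U V h, hg U V h]
  one_mem' := by
    intro U V h
    rw [Pi.one_apply, Pi.one_apply, map_one]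
  inv_mem' := by
    intro f hf U V h
    rw [Pi.inv_apply, Pi.inv_apply, map_inv, hf U V h]

/-- The pro-`2` completion of `Γ`, a topological group for the topology induced by the product of
the discrete groups `Γ / U`. -/
abbrev ProTwoCompletion : Type := compatibleFamilies Γ

/-- The canonical map from `Γ` to its pro-`2` completion. -/
def toCompletion : Γ →* ProTwoCompletion Γ where
  toFun g := ⟨fun U => toFinQuot U g, fun _ _ _ => rfl⟩
  map_one' := by
    apply Subtype.ext
    funext U
    exact map_one (toFinQuot U)
  map_mul' g h := by
    apply Subtype.ext
    funext U
    exact map_mul (toFinQuot U) g h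

variable {Γ}

/-- The projection of the pro-`2` completion to `Γ / U`. -/
def proj (U : TwoPowerNormal Γ) : ProTwoCompletion Γ →* FinQuot U :=
  (Pi.evalMonoidHom _ U).comp (compatibleFamilies Γ).subtype

variable {P : Type} [Group P] [Finite P]

/-- The kernel of a homomorphism to a finite `2`-group. -/
def kerTwoPower (hP : IsPGroup 2 P) (f : Γ →* P) : TwoPowerNormal Γ where
  toSubgroup := f.ker
  normal := inferInstance
  index_eq := by
    rw [Subgroup.index_ker]
    exact IsPGroup.iff_card.mp (hP.to_subgroup f.range)

/-- The continuous extension to the pro-`2` completion of a homomorphism from `Γ` to a finite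
`2`-group. -/
def extend (hP : IsPGroup 2 P) (f : Γ →* P) : ProTwoCompletion Γ →* P :=
  MonoidHom.comp (N := FinQuot (kerTwoPower hP f)) (QuotientGroup.kerLift f)
    (proj (kerTwoPower hP f))

theorem extend_toCompletion (hP : IsPGroup 2 P) (f : Γ →* P) (g : Γ) :
    extend hP f (toCompletion Γ g) = f g := rfl

theorem continuous_extend [TopologicalSpace P] (hP : IsPGroup 2 P) (f : Γ →* P) :
    Continuous (extend hP f) := by
  have h1 : Continuous (fun q : FinQuot (kerTwoPower hP f) => (QuotientGroup.kerLift f q : P)) :=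
    continuous_of_discreteTopology
  have h2 : Continuous (proj (kerTwoPower hP f)) :=
    (continuous_apply (kerTwoPower hP f)).comp continuous_subtype_val
  exact h1.comp h2

end Completion

/-- The free pro-`2` group of rank two. -/
abbrev F₂ : Type := ProTwoCompletion (FreeGroup (Fin 2))

/-- The first free generator. -/
def a : F₂ := toCompletion _ (FreeGroup.of 0)

/-- The second free generator. -/
def b : F₂ := toCompletion _ (FreeGroup.of 1)

/-! ### The wreath products `C₂ ≀ C_{2^k}` -/

/-- The wreath product of a cyclic group of order `2` by a cyclic group of order `2 ^ k`. -/
abbrev W (k : ℕ) : Type := Multiplicative (ZMod 2) ≀ᵣ Multiplicative (ZMod (2 ^ k))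

/-- The generator of the top group. -/
def xW (k : ℕ) : W k := RegularWreathProduct.inl (Multiplicative.ofAdd 1)

/-- The generator of the copy of `C₂` with index `1` in the base group. -/
def yW (k : ℕ) : W k := ⟨Pi.mulSingle 1 (Multiplicative.ofAdd 1), 1⟩

/-- The base group. -/
def B (k : ℕ) : Subgroup (W k) := (RegularWreathProduct.rightHom (D := Multiplicative (ZMod 2))
  (Q := Multiplicative (ZMod (2 ^ k)))).ker

instance finite_cyclic (k : ℕ) : Finite (Multiplicative (ZMod (2 ^ k))) :=
  Finite.of_equiv (ZMod (2 ^ k)) Multiplicative.ofAdd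

theorem isPGroup_W (k : ℕ) : IsPGroup 2 (W k) := by
  refine IsPGroup.of_card (n := 2 ^ k + k) ?_
  rw [RegularWreathProduct.card]
  have h1 : Nat.card (Multiplicative (ZMod (2 ^ k))) = 2 ^ k := Nat.card_zmod _
  have h2 : Nat.card (Multiplicative (ZMod 2)) = 2 := Nat.card_zmod _
  rw [h1, h2, pow_add]

/-- The continuous homomorphism from the free pro-`2` group to the wreath product that maps
`a` and `b` to the standard generators. -/
def toW (k : ℕ) : F₂ →* W k := extend (isPGroup_W k) (FreeGroup.lift ![xW k, yW k])

theorem toW_a (k : ℕ) : toW k a = xW k := by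
  simp [toW, a, extend_toCompletion]

theorem toW_b (k : ℕ) : toW k b = yW k := by
  simp [toW, b, extend_toCompletion]

/-! ### The groups `G_k` -/

/-- The kernel of the map to the wreath product. -/
def R (k : ℕ) : Subgroup F₂ := (toW k).ker

/-- The preimage of the base group. -/
def Y (k : ℕ) : Subgroup F₂ := (B k).comap (toW k)

instance (k : ℕ) : (R k).Normal := by unfold R; infer_instance

instance (k : ℕ) : (Y k).Normal := by unfold Y B; infer_instance

/-- The subgroup generated by the squares of the elements of `R k`. -/
def squaresR (k : ℕ) : Subgroup F₂ := Subgroup.closure {g | ∃ r ∈ R k, g = r ^ 2}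

instance (k : ℕ) : (squaresR k).Normal := by
  unfold squaresR
  refine ⟨fun n hn g => ?_⟩
  induction hn using Subgroup.closure_induction with
  | mem u hu =>
    obtain ⟨r, hr, rfl⟩ := hu
    refine Subgroup.subset_closure ⟨g * r * g⁻¹, (inferInstance : (R k).Normal).conj_mem r hr g, ?_⟩
    exact (conj_pow).symm
  | one => simp
  | mul u v _ _ hu hv => simpa [mul_assoc] using Subgroup.mul_mem _ hu hv
  | inv u _ hu => simpa [mul_assoc] using Subgroup.inv_mem _ hu

/-- The closed normal subgroup `[R_k, Y_k] R_k² ⟨a ^ (2 ^ k)⟩^{F₂}`. -/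
def N (k : ℕ) : Subgroup F₂ :=
  (⁅R k, Y k⁆ ⊔ squaresR k ⊔ Subgroup.normalClosure {a ^ 2 ^ k}).topologicalClosure

instance (k : ℕ) : (N k).Normal := by
  unfold N
  exact Subgroup.is_normal_topologicalClosure _

/-- The group `G_k = F₂ / N_k`. -/
abbrev G (k : ℕ) : Type := F₂ ⧸ N k

/-- The image of `a` in `G_k`. -/
def x (k : ℕ) : G k := QuotientGroup.mk a

/-- The image of `b` in `G_k`. -/
def y (k : ℕ) : G k := QuotientGroup.mk b

/-! ### Commutators and the lower central series -/

/-- The commutator `[g, h] = g⁻¹ h⁻¹ g h`. -/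
def comm {Γ : Type} [Group Γ] (g h : Γ) : Γ := g⁻¹ * h⁻¹ * g * h

/-- The left-normed commutator `[g, h, …, h]` with `n` entries `h`. -/
def iterComm {Γ : Type} [Group Γ] (g h : Γ) (n : ℕ) : Γ := (fun u => comm u h)^[n] g

/-- `c_i = [y, x, …, x]` with `i - 1` entries `x`, for `i ≥ 1`. -/
def c (k i : ℕ) : G k := iterComm (y k) (x k) (i - 1)

/-- `c_{i,j} = [c_i, y, x, …, x]` with `j - 1` entries `x`, for `i, j ≥ 1`. -/
def cc (k i j : ℕ) : G k := iterComm (comm (c k i) (y k)) (x k) (j - 1)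

/-- The lower central series of `G_k`, numbered from `γ_1(G_k) = G_k`. -/
def γ (k i : ℕ) : Subgroup (G k) := (⊤ : Subgroup (G k)).lowerCentralSeries (i - 1)

instance (k i : ℕ) : (γ k i).Normal := by unfold γ; infer_instance

/-- The quotient `γ_i(G_k) / γ_{i+1}(G_k)`. -/
abbrev factor (k i : ℕ) : Type := γ k i ⧸ (γ k (i + 1)).subgroupOf (γ k i)

/-- The cyclic group of order `n` (for `n ≥ 1`). -/
abbrev C (n : ℕ) : Type := Multiplicative (ZMod n)

end WreathCover

end

open WreathCover

/-! The group `G k` is embedded in an explicit finite group `Model k`, where commutators become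
polynomial arithmetic. Write `S = s - 1`, `T = t - 1` in the group algebra of `C_{2^k} × C_{2^k}`
over the field with two elements, so that `S ^ 2^k = T ^ 2^k = 0`. The image of `R k` in `G k` is an
elementary abelian 2-group centralized by the image of `Y k`. Hence squares and commutators of base
elements `u`, `v` depend only on their images in the wreath product; the model records them as `u *
swap u` and `u * swap v + v * swap u`. Commutation with `x` multiplies the middle coordinate by `S`
and, on elements with zero middle coordinate, the bottom coordinate by `delta = (1 + S)(1 + T) - 1`.

The model is faithful (`model_faithful`, `model_injective`): a word in `x`, `y` is an `x`-power
times conjugates of `y`, and the coordinates of its image read off first the power, then the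
exponents of the conjugates, then those of their squares and commutators. Since `N k` is closed, the
statement passes from words to the free pro-2 group.

In the model, `c_i` has middle coordinate `S^(i-1)`, and `c_{i,j}` is the element `delta^(j-1) *
(S^(i-1) + T^(i-1))` of the bottom. Filter the span of the symmetrized monomials by degree. By
`alt_le_altGens` each step of this filtration is spanned by the `c_{m,n}` with `m` even, `m ≤ 2^k`,
`n ≤ 2^k - 1`, and so `γ_i` is generated modulo `γ_{i+1}` by these and `c_i` (`γ_eq_c_sup_ccGens`).
Moreover `tailSeq_two_pow_add` shows that `c_{2^k+r+1}` and the square of `c_{2^(k-1)+r+1}` agree up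
to elements of the bottom that lie deeper in the series. So `c_i ^ 2` lies in `γ_{i+1}` once `i >
2^(k-1)`, and `c_i` itself does once `i > 2^k + 2^(k-1)`.

This bounds each factor from above. The product of the bounds equals the number `2^(k + 2^k +
binom(2^k+1, 2))` of distinct elements of `G k` exhibited in `two_pow_le_card`, so every bound is
attained (`card_factor`) and the surjections onto the factors are isomorphisms. -/

noncomputable section

namespace WreathCover

/-! ### Alternating elements in a truncated polynomial ring of characteristic two -/

section Alternating

variable {A : Type*} [CommRing A]

/-- The symmetrization of the monomial `S ^ a * T ^ b`. -/
def symm (S T : A) (a b : ℕ) : A := S ^ a * T ^ b + S ^ b * T ^ a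

/-- The additive span of the symmetrized monomials of degree at least `d`. -/
def alt (S T : A) (d : ℕ) : AddSubgroup A :=
  AddSubgroup.closure {e | ∃ a b : ℕ, d ≤ a + b ∧ e = symm S T a b}

/-- The element `(1 + S) * (1 + T) - 1`. -/
def delta (S T : A) : A := S + T + S * T

variable {S T : A}

theorem symm_mem_alt {a b d : ℕ} (h : d ≤ a + b) : symm S T a b ∈ alt S T d :=
  AddSubgroup.subset_closure ⟨a, b, h, rfl⟩

theorem alt_anti {d e : ℕ} (h : d ≤ e) : alt S T e ≤ alt S T d := by
  refine (AddSubgroup.closure_le _).2 ?_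
  rintro _ ⟨a, b, hab, rfl⟩
  exact symm_mem_alt (h.trans hab)

theorem add_mul_symm (a b : ℕ) :
    (S + T) * symm S T a b = symm S T (a + 1) b + symm S T a (b + 1) := by
  unfold symm; ring

theorem mul_mul_symm (a b : ℕ) : S * T * symm S T a b = symm S T (a + 1) (b + 1) := by
  unfold symm; ring

theorem add_mul_mem_alt {d : ℕ} {u : A} (hu : u ∈ alt S T d) : (S + T) * u ∈ alt S T (d + 1) := by
  induction hu using AddSubgroup.closure_induction with
  | mem u hu =>
    obtain ⟨a, b, hab, rfl⟩ := hu
    rw [add_mul_symm]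
    exact add_mem (symm_mem_alt (by omega)) (symm_mem_alt (by omega))
  | zero => simp
  | add u v _ _ hu hv => rw [mul_add]; exact add_mem hu hv
  | neg u _ hu => rw [mul_neg]; exact neg_mem hu

theorem mul_mul_mem_alt {d : ℕ} {u : A} (hu : u ∈ alt S T d) : S * T * u ∈ alt S T (d + 2) := by
  induction hu using AddSubgroup.closure_induction with
  | mem u hu =>
    obtain ⟨a, b, hab, rfl⟩ := hu
    rw [mul_mul_symm]
    exact symm_mem_alt (by omega)
  | zero => simp
  | add u v _ _ hu hv => rw [mul_add]; exact add_mem hu hv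
  | neg u _ hu => rw [mul_neg]; exact neg_mem hu

theorem delta_mul_mem_alt {d : ℕ} {u : A} (hu : u ∈ alt S T d) :
    delta S T * u ∈ alt S T (d + 1) := by
  rw [delta, add_mul]
  exact add_mem (add_mul_mem_alt hu) (alt_anti (by omega) (mul_mul_mem_alt hu))

theorem delta_pow_mul_mem_alt {d : ℕ} {u : A} (hu : u ∈ alt S T d) (j : ℕ) :
    delta S T ^ j * u ∈ alt S T (d + j) := by
  induction j with
  | zero => simpa using hu
  | succ j ih =>
    rw [pow_succ', mul_assoc]
    exact delta_mul_mem_alt ih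

theorem add_pow_mul_mem_alt {d : ℕ} {u : A} (hu : u ∈ alt S T d) (j : ℕ) :
    (S + T) ^ j * u ∈ alt S T (d + j) := by
  induction j with
  | zero => simpa using hu
  | succ j ih =>
    rw [pow_succ', mul_assoc]
    exact add_mul_mem_alt ih

theorem mul_pow_mul_mem_alt {d : ℕ} {u : A} (hu : u ∈ alt S T d) (j : ℕ) :
    (S * T) ^ j * u ∈ alt S T (d + 2 * j) := by
  induction j with
  | zero => simpa using hu
  | succ j ih =>
    rw [pow_succ', mul_assoc]
    exact mul_mul_mem_alt ih

variable [CharP A 2]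

theorem symm_self (a : ℕ) : symm S T a a = 0 := CharTwo.add_self_eq_zero _

/-- The only symmetrized monomial of degree zero is `1 + 1 = 0`. -/
theorem alt_zero_le : alt S T 0 ≤ alt S T 1 := by
  refine (AddSubgroup.closure_le _).2 ?_
  rintro _ ⟨a, b, -, rfl⟩
  rcases Nat.eq_zero_or_pos (a + b) with h | h
  · obtain ⟨rfl, rfl⟩ : a = 0 ∧ b = 0 := by omega
    rw [symm_self]
    exact zero_mem _
  · exact symm_mem_alt h

/-- Diagonal symmetrizations vanish in characteristic two; if `a ≠ b` and `a + b ≥ 2n - 2`, one of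
the exponents is at least `n`. -/
theorem alt_eq_bot {n d : ℕ} (hS : S ^ n = 0) (hT : T ^ n = 0) (hd : 2 * n ≤ d + 2) :
    alt S T d = ⊥ := by
  refine AddSubgroup.closure_eq_bot_iff.2 ?_
  rintro _ ⟨a, b, hab, rfl⟩
  rw [Set.mem_singleton_iff]
  by_cases h : a = b
  · rw [h, symm_self]
  · rcases le_or_gt n a with h1 | h1
    · rw [symm, pow_eq_zero_of_le h1 hS, pow_eq_zero_of_le h1 hT]; simp
    · have h2 : n ≤ b := by omega
      rw [symm, pow_eq_zero_of_le h2 hS, pow_eq_zero_of_le h2 hT]; simp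

/-- In characteristic two the complete homogeneous polynomial of degree `2 ^ k - 1` in two
variables is a power of their sum. -/
theorem geom_sum_two_pow (u v : A) (k : ℕ) :
    ∑ j ∈ Finset.range (2 ^ k), u ^ j * v ^ (2 ^ k - 1 - j) = (u + v) ^ (2 ^ k - 1) := by
  induction k with
  | zero => simp
  | succ k ih =>
    have h1 : 0 < 2 ^ k := by positivity
    have h2 : 2 ^ (k + 1) = 2 ^ k + 2 ^ k := by ring
    -- The two halves of the sum are `v ^ 2^k` and `u ^ 2^k` times the previous sum, and `u ^ 2^k +
    -- v ^ 2^k = (u + v) ^ 2^k`.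
    rw [h2, Finset.sum_range_add]
    have e1 : ∀ j ∈ Finset.range (2 ^ k), u ^ j * v ^ (2 ^ k + 2 ^ k - 1 - j) =
        v ^ 2 ^ k * (u ^ j * v ^ (2 ^ k - 1 - j)) := by
      intro j hj
      rw [Finset.mem_range] at hj
      rw [show 2 ^ k + 2 ^ k - 1 - j = 2 ^ k + (2 ^ k - 1 - j) by omega, pow_add]
      ring
    have e2 : ∀ j ∈ Finset.range (2 ^ k), u ^ (2 ^ k + j) * v ^ (2 ^ k + 2 ^ k - 1 - (2 ^ k + j)) =
        u ^ 2 ^ k * (u ^ j * v ^ (2 ^ k - 1 - j)) := by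
      intro j hj
      rw [show 2 ^ k + 2 ^ k - 1 - (2 ^ k + j) = 2 ^ k - 1 - j by omega, pow_add]
      ring
    rw [Finset.sum_congr rfl e1, Finset.sum_congr rfl e2, ← Finset.mul_sum, ← Finset.mul_sum, ih,
      ← add_mul, show 2 ^ k + 2 ^ k - 1 = 2 ^ k + (2 ^ k - 1) by omega, pow_add, add_comm u v,
      add_pow_char_pow]

/-- The generators of degree `d` of the alternating elements. -/
def altGens (S T : A) (n d : ℕ) : Set A :=
  {e | ∃ a j : ℕ, Odd a ∧ a < n ∧ j + 2 ≤ n ∧ a + j = d ∧ e = delta S T ^ j * symm S T a 0}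

/-- One degree more than expected is gained. Expand `delta ^ (2^k - 1)` as the sum of the `(S * T)^j
* (S + T)^(2^k - 1 - j)`. The terms with `j > 0` gain at least one degree because `S * T` has degree
two. The term `j = 0` vanishes: `S + T` divides `S^a + T^a`, and `(S + T)^(2^k) = 0`. -/
theorem delta_pow_mul_symm_mem {k : ℕ} (hS : S ^ 2 ^ k = 0) (hT : T ^ 2 ^ k = 0) (a : ℕ) :
    delta S T ^ (2 ^ k - 1) * symm S T a 0 ∈ alt S T (a + 2 ^ k) := by
  have hpos : 0 < 2 ^ k := by positivity
  have hP : (S + T) ^ 2 ^ k = 0 := by rw [add_pow_char_pow, hS, hT, add_zero]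
  have hdvd : (S + T) ∣ symm S T a 0 := by
    have := sub_dvd_pow_sub_pow S T a
    rw [CharTwo.sub_eq_add, CharTwo.sub_eq_add] at this
    simpa [symm] using this
  obtain ⟨w, hw⟩ := hdvd
  rw [delta, add_comm (S + T), ← geom_sum_two_pow, Finset.sum_mul]
  refine sum_mem fun j hj => ?_
  rw [Finset.mem_range] at hj
  rcases Nat.eq_zero_or_pos j with rfl | hj0
  · have : (S * T) ^ 0 * (S + T) ^ (2 ^ k - 1 - 0) * symm S T a 0 = (S + T) ^ 2 ^ k * w := by
      rw [hw, Nat.sub_zero, pow_zero, one_mul, ← mul_assoc, ← pow_succ, Nat.sub_add_cancel hpos]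
    rw [this, hP, zero_mul]
    exact zero_mem _
  · have h := mul_pow_mul_mem_alt (add_pow_mul_mem_alt
      (symm_mem_alt (S := S) (T := T) (a := a) (b := 0) (le_refl a)) (2 ^ k - 1 - j)) j
    rw [mul_assoc]
    exact alt_anti (by omega) h

/-- Multiplying generators of degree `d` by `delta` shows that `(S + T) * symm a b` is trivial
modulo the span when `a + b = d`. Hence all symmetrizations of degree `d + 1` are congruent to each
other. In even degree one of them is diagonal, so zero; in odd degree the one with `b = 0` is a
generator or zero. -/
theorem alt_le_altGens {k : ℕ} (hS : S ^ 2 ^ k = 0) (hT : T ^ 2 ^ k = 0) (d : ℕ) :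
    alt S T d ≤ AddSubgroup.closure (altGens S T (2 ^ k) d) ⊔ alt S T (d + 1) := by
  induction d with
  | zero => exact alt_zero_le.trans le_sup_right
  | succ d ih =>
    set X := AddSubgroup.closure (altGens S T (2 ^ k) (d + 1)) ⊔ alt S T (d + 1 + 1) with hX
    have hX2 : alt S T (d + 2) ≤ X := le_sup_right
    have hgen : ∀ u ∈ AddSubgroup.closure (altGens S T (2 ^ k) d), delta S T * u ∈ X := by
      intro u hu
      induction hu using AddSubgroup.closure_induction with
      | mem u hu =>
        obtain ⟨a, j, ha, han, hj, hd, rfl⟩ := hu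
        rw [← mul_assoc, ← pow_succ']
        by_cases hj' : j + 1 + 2 ≤ 2 ^ k
        · exact (le_sup_left : _ ≤ X)
            (AddSubgroup.subset_closure ⟨a, j + 1, ha, han, hj', by omega, rfl⟩)
        -- The power of `delta` leaves the permitted range exactly here, and the extra degree gained
        -- makes the product negligible.
        · rw [show j + 1 = 2 ^ k - 1 by omega]
          exact hX2 (alt_anti (by omega) (delta_pow_mul_symm_mem hS hT a))
      | zero => simp
      | add u v _ _ hu hv => rw [mul_add]; exact add_mem hu hv
      | neg u _ hu => rw [mul_neg]; exact neg_mem hu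
    have hdelta : ∀ u ∈ alt S T d, delta S T * u ∈ X := by
      intro u hu
      obtain ⟨v, hv, w, hw, rfl⟩ := AddSubgroup.mem_sup.1 (ih hu)
      rw [mul_add]
      exact add_mem (hgen v hv) (hX2 (delta_mul_mem_alt hw))
    have hstep : ∀ a b : ℕ, a + b = d → symm S T (a + 1) b + symm S T a (b + 1) ∈ X := by
      intro a b hab
      have h1 := hdelta _ (symm_mem_alt (S := S) (T := T) hab.ge)
      have h2 : symm S T (a + 1) (b + 1) ∈ X := hX2 (symm_mem_alt (by omega))
      rw [delta, add_mul, add_mul_symm, mul_mul_symm] at h1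
      exact (AddSubgroup.add_mem_cancel_right _ h2).1 h1
    have hall : ∀ a b : ℕ, a + b = d + 1 → (symm S T a b ∈ X ↔ symm S T (d + 1) 0 ∈ X) := by
      intro a b
      induction b generalizing a with
      | zero => intro h; rw [show a = d + 1 by omega]
      | succ b ihb =>
        intro h
        rw [← ihb (a + 1) (by omega)]
        have := hstep a b (by omega)
        constructor
        · exact fun h => (AddSubgroup.add_mem_cancel_right _ h).1 this
        · exact fun h => (AddSubgroup.add_mem_cancel_left _ h).1 this
    have hbase : symm S T (d + 1) 0 ∈ X := by
      rcases Nat.even_or_odd (d + 1) with ⟨e, he⟩ | ho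
      · rw [← hall e e he.symm, symm_self]
        exact zero_mem _
      · by_cases hdn : d + 1 < 2 ^ k
        · refine (le_sup_left : _ ≤ X) (AddSubgroup.subset_closure ⟨d + 1, 0, ho, hdn, ?_, rfl, ?_⟩)
          · omega
          · simp
        · rw [symm, pow_eq_zero_of_le (not_lt.1 hdn) hS, pow_eq_zero_of_le (not_lt.1 hdn) hT]
          simp
    refine (AddSubgroup.closure_le _).2 ?_
    rintro _ ⟨a, b, hab, rfl⟩
    rcases hab.eq_or_lt with h | h
    · exact (hall a b h.symm).2 hbase
    · exact hX2 (symm_mem_alt h)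

/-- The second coordinate of the iterated commutators `[y, x, …, x]`. -/
def tailSeq (S T : A) : ℕ → A
  | 0 => 0
  | i + 1 => delta S T * tailSeq S T i + S ^ i * T ^ (i + 1)

omit [CharP A 2] in
theorem tailSeq_eq_sum (i : ℕ) :
    tailSeq S T i = T * ∑ j ∈ Finset.range i, (S * T) ^ j * delta S T ^ (i - 1 - j) := by
  induction i with
  | zero => simp [tailSeq]
  | succ i ih =>
    have e : ∀ j ∈ Finset.range i, (S * T) ^ j * delta S T ^ (i + 1 - 1 - j) =
        delta S T * ((S * T) ^ j * delta S T ^ (i - 1 - j)) := by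
      intro j hj
      rw [Finset.mem_range] at hj
      rw [show i + 1 - 1 - j = i - 1 - j + 1 by omega, pow_succ]
      ring
    rw [tailSeq, ih, Finset.sum_range_succ, Finset.sum_congr rfl e, ← Finset.mul_sum]
    simp only [Nat.add_sub_cancel, Nat.sub_self]
    ring

/-- As `delta + S * T = S + T`, the closed form sums to `T * (S + T)^(2^k - 1)`, which is `T` times
the sum of all monomials of degree `2^k - 1`. After `T ^ 2^k = 0` is discarded, the monomials pair
off into symmetrizations, except the middle one. -/
theorem tailSeq_two_pow {k : ℕ} (hk : 1 ≤ k) (hS : S ^ 2 ^ k = 0) (hT : T ^ 2 ^ k = 0) :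
    tailSeq S T (2 ^ k) - S ^ 2 ^ (k - 1) * T ^ 2 ^ (k - 1) ∈ alt S T (2 ^ k) := by
  obtain ⟨l, rfl⟩ : ∃ l, k = l + 1 := ⟨k - 1, by omega⟩
  simp only [Nat.add_sub_cancel]
  set m := 2 ^ l with hm
  have hmpos : 0 < m := by positivity
  have h2 : 2 ^ (l + 1) = m + m := by rw [hm]; ring
  have hpow : delta S T + S * T = S + T := by
    rw [delta, add_assoc, CharTwo.add_self_eq_zero, add_zero]
  rw [tailSeq_eq_sum, geom_sum_two_pow, add_comm (S * T), hpow]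
  rw [h2] at hS hT ⊢
  rw [show m + m - 1 = m + (m - 1) by omega, pow_add, hm, add_pow_char_pow, ← geom_sum_two_pow,
    ← hm, Finset.mul_sum, Finset.mul_sum]
  obtain ⟨m', hm'⟩ : ∃ m', m = m' + 1 := ⟨m - 1, by omega⟩
  rw [hm'] at hS hT ⊢
  simp only [Nat.add_sub_cancel]
  have e : ∀ j ∈ Finset.range (m' + 1), T * ((S ^ (m' + 1) + T ^ (m' + 1)) * (S ^ j * T ^ (m' - j)))
      = S ^ (m' + 1 + j) * T ^ (m' + 1 - j) + S ^ j * T ^ (m' + 1 + (m' + 1 - j)) := by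
    intro j hj
    rw [Finset.mem_range] at hj
    rw [show m' + 1 - j = m' - j + 1 by omega]
    ring
  -- The terms `j = 0` are split off: the first is the middle monomial, the second contains `T ^
  -- 2^k`. Reversing the order of the second family aligns each monomial with its mirror image in
  -- the first.
  rw [Finset.sum_congr rfl e, Finset.sum_add_distrib, Finset.sum_range_succ',
    Finset.sum_range_succ' (fun j => S ^ j * T ^ (m' + 1 + (m' + 1 - j))), ← Finset.sum_range_reflect
    (fun j => S ^ (j + 1) * T ^ (m' + 1 + (m' + 1 - (j + 1))))]
  simp only [Nat.sub_zero, hT, pow_zero, mul_zero, add_zero]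
  rw [add_right_comm _ (S ^ (m' + 1) * T ^ (m' + 1)), add_sub_cancel_right, ← Finset.sum_add_distrib]
  refine sum_mem fun j hj => ?_
  rw [Finset.mem_range] at hj
  have : S ^ (m' + 1 + (j + 1)) * T ^ (m' + 1 - (j + 1)) +
      S ^ (m' - 1 - j + 1) * T ^ (m' + 1 + (m' + 1 - (m' - 1 - j + 1))) =
      symm S T (m' + 1 + (j + 1)) (m' + 1 - (j + 1)) := by
    rw [symm, show m' - 1 - j + 1 = m' + 1 - (j + 1) by omega,
      show m' + 1 + (m' + 1 - (m' + 1 - (j + 1))) = m' + 1 + (j + 1) by omega]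
  rw [this]
  exact symm_mem_alt (by omega)

/-- Beyond index `2^k` the inhomogeneous term of the recursion contains `S ^ 2^k = 0`, so only
multiplication by `delta` remains; it sends `S^l * T^l` to `S^(l+1) * T^(l+1)` plus a
symmetrization. -/
theorem tailSeq_two_pow_add {k : ℕ} (hk : 1 ≤ k) (hS : S ^ 2 ^ k = 0) (hT : T ^ 2 ^ k = 0)
    (r : ℕ) : tailSeq S T (2 ^ k + r) - S ^ (2 ^ (k - 1) + r) * T ^ (2 ^ (k - 1) + r) ∈
      alt S T (2 ^ k + r) := by
  induction r with
  | zero => exact tailSeq_two_pow hk hS hT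
  | succ r ih =>
    set l := 2 ^ (k - 1) + r with hl
    have h2 : 2 ^ k = 2 ^ (k - 1) + 2 ^ (k - 1) := by
      obtain ⟨l, rfl⟩ : ∃ l, k = l + 1 := ⟨k - 1, by omega⟩
      simp only [Nat.add_sub_cancel]; ring
    have e : tailSeq S T (2 ^ k + (r + 1)) - S ^ (l + 1) * T ^ (l + 1) =
        delta S T * (tailSeq S T (2 ^ k + r) - S ^ l * T ^ l) + symm S T (l + 1) l := by
      rw [← add_assoc, tailSeq, pow_add S, hS, delta, symm]
      ring
    rw [show 2 ^ (k - 1) + (r + 1) = l + 1 by omega, e]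
    exact add_mem (delta_mul_mem_alt ih) (symm_mem_alt (by omega))

end Alternating

/-! ### The model group -/

section Model

/-- The group algebra of `C_{2^k} × C_{2^k}` over the field with two elements. -/
abbrev Alg (k : ℕ) : Type := MonoidAlgebra (ZMod 2) (C (2 ^ k) × C (2 ^ k))

instance (k : ℕ) : CharP (Alg k) 2 :=
  charP_of_injective_algebraMap (FaithfulSMul.algebraMap_injective (ZMod 2) (Alg k)) 2

instance (k : ℕ) : Finite (Alg k) :=
  Finite.of_equiv (C (2 ^ k) × C (2 ^ k) →₀ ZMod 2) MonoidAlgebra.coeffEquiv.symm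

/-- The first copy of `C_{2^k}` in the group algebra. -/
def fst (k : ℕ) : C (2 ^ k) →* Alg k := (MonoidAlgebra.of _ _).comp (MonoidHom.inl _ _)

/-- The second copy of `C_{2^k}` in the group algebra. -/
def snd (k : ℕ) : C (2 ^ k) →* Alg k := (MonoidAlgebra.of _ _).comp (MonoidHom.inr _ _)

/-- The exchange of the two factors. -/
def swap (k : ℕ) : Alg k →+* Alg k :=
  MonoidAlgebra.mapDomainRingHom (ZMod 2) (MulEquiv.prodComm (M := C (2 ^ k)) (N := C (2 ^ k))).toMonoidHom

variable {k : ℕ}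

theorem fst_eq_single (q : C (2 ^ k)) : fst k q = MonoidAlgebra.single (q, 1) 1 := rfl

theorem snd_eq_single (q : C (2 ^ k)) : snd k q = MonoidAlgebra.single (1, q) 1 := rfl

theorem fst_mul_snd (q r : C (2 ^ k)) : fst k q * snd k r = MonoidAlgebra.single (q, r) 1 := by
  simp [fst_eq_single, snd_eq_single, MonoidAlgebra.single_mul_single]

theorem swap_fst (q : C (2 ^ k)) : swap k (fst k q) = snd k q := by
  simp [swap, fst_eq_single, snd_eq_single]

/-- The generator of `C_{2^k}`. -/
def gen (k : ℕ) : C (2 ^ k) := Multiplicative.ofAdd 1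

theorem gen_pow : gen k ^ 2 ^ k = 1 := by
  rw [gen, ← ofAdd_nsmul, nsmul_one, ZMod.natCast_self, ofAdd_zero]

/-- The element `s - 1` of the group algebra. -/
def Sv (k : ℕ) : Alg k := fst k (gen k) - 1

/-- The element `t - 1` of the group algebra. -/
def Tv (k : ℕ) : Alg k := snd k (gen k) - 1

theorem Sv_pow : Sv k ^ 2 ^ k = 0 := by
  rw [Sv, sub_pow_char_pow, ← map_pow, gen_pow, map_one, one_pow, sub_self]

theorem Tv_pow : Tv k ^ 2 ^ k = 0 := by
  rw [Tv, sub_pow_char_pow, ← map_pow, gen_pow, map_one, one_pow, sub_self]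

theorem swap_Sv : swap k (Sv k) = Tv k := by
  rw [Sv, map_sub, swap_fst, map_one, Tv]

variable (k)

/-- The model of the cover of the wreath product: an extension of the group algebra by itself,
extended by the cyclic group `C_{2^k}`. -/
@[ext]
structure Model : Type where
  top : C (2 ^ k)
  mid : Alg k
  bot : Alg k

variable {k}

namespace Model

/-- An element is read as top part, then base part, then central part. Moving `h.top` to the left
past `g` acts on the base part by `s` and on the central part by `s * t`. The bilinear cocycle `u *
swap v` yields squares on its diagonal and commutators by symmetrization. -/
instance : Mul (Model k) :=
  ⟨fun g h => ⟨g.top * h.top, fst k h.top * g.mid + h.mid,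
    fst k h.top * snd k h.top * g.bot + h.bot + fst k h.top * g.mid * swap k h.mid⟩⟩

instance : One (Model k) := ⟨⟨1, 0, 0⟩⟩

instance : Inv (Model k) :=
  ⟨fun g => ⟨g.top⁻¹, -(fst k g.top⁻¹ * g.mid),
    fst k g.top⁻¹ * snd k g.top⁻¹ * (g.mid * swap k g.mid - g.bot)⟩⟩

@[simp] theorem mul_top (g h : Model k) : (g * h).top = g.top * h.top := rfl

@[simp] theorem mul_mid (g h : Model k) : (g * h).mid = fst k h.top * g.mid + h.mid := rfl

@[simp] theorem mul_bot (g h : Model k) : (g * h).bot =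
    fst k h.top * snd k h.top * g.bot + h.bot + fst k h.top * g.mid * swap k h.mid := rfl

@[simp] theorem one_top : (1 : Model k).top = 1 := rfl

@[simp] theorem one_mid : (1 : Model k).mid = 0 := rfl

@[simp] theorem one_bot : (1 : Model k).bot = 0 := rfl

@[simp] theorem inv_top (g : Model k) : (g⁻¹).top = g.top⁻¹ := rfl

@[simp] theorem inv_mid (g : Model k) : (g⁻¹).mid = -(fst k g.top⁻¹ * g.mid) := rfl

@[simp] theorem inv_bot (g : Model k) :
    (g⁻¹).bot = fst k g.top⁻¹ * snd k g.top⁻¹ * (g.mid * swap k g.mid - g.bot) := rfl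

instance : Group (Model k) := Group.ofLeftAxioms
  (by
    intro g h l
    ext1
    · simp [mul_assoc]
    · simp only [mul_mid, mul_top, map_mul]; ring
    · simp only [mul_mid, mul_top, mul_bot, map_mul, map_add, swap_fst]; ring)
  (by intro g; ext1 <;> simp)
  (by
    intro g
    have h1 : fst k g.top * fst k g.top⁻¹ = 1 := by rw [← map_mul, mul_inv_cancel, map_one]
    have h2 : snd k g.top * snd k g.top⁻¹ = 1 := by rw [← map_mul, mul_inv_cancel, map_one]
    ext1
    · simp
    · simp only [mul_mid, inv_mid, one_mid]
      linear_combination -g.mid * h1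
    · simp only [mul_bot, inv_mid, inv_bot, one_bot]
      linear_combination (-g.mid * swap k g.mid +
        (snd k g.top * snd k g.top⁻¹) * (g.mid * swap k g.mid - g.bot)) * h1 +
          (g.mid * swap k g.mid - g.bot) * h2)

instance : Finite (Model k) :=
  Finite.of_injective (fun g : Model k => (g.top, g.mid, g.bot)) (by
    rintro ⟨a, b, c⟩ ⟨a', b', c'⟩ h
    simpa using h)

theorem isPGroup (k : ℕ) : IsPGroup 2 (Model k) := by
  let e : Model k ≃ C (2 ^ k) × Alg k × Alg k :=
    ⟨fun g => (g.top, g.mid, g.bot), fun g => ⟨g.1, g.2.1, g.2.2⟩, fun _ => rfl, fun _ => rfl⟩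
  have h1 : Nat.card (C (2 ^ k)) = 2 ^ k := Nat.card_zmod _
  have h2 : Nat.card (Alg k) = 2 ^ (2 ^ k * 2 ^ k) := by
    have h4 : Nat.card (ZMod 2) = 2 := Nat.card_zmod _
    rw [Nat.card_congr (MonoidAlgebra.coeffEquiv.trans Finsupp.equivFunOnFinite), Nat.card_fun,
      Nat.card_prod, h1, h4]
  refine IsPGroup.of_card (n := k + (2 ^ k * 2 ^ k + 2 ^ k * 2 ^ k)) ?_
  rw [Nat.card_congr e, Nat.card_prod, Nat.card_prod, h1, h2, pow_add, pow_add]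

/-- The first generator. -/
def x (k : ℕ) : Model k := ⟨gen k, 0, 0⟩

/-- The second generator. -/
def y (k : ℕ) : Model k := ⟨1, 1, 0⟩

theorem x_pow (m : ℕ) : x k ^ m = ⟨gen k ^ m, 0, 0⟩ := by
  induction m with
  | zero => rw [pow_zero, pow_zero]; rfl
  | succ m ih => rw [pow_succ, ih]; ext1 <;> simp [x, pow_succ]

theorem x_pow_two_pow : x k ^ 2 ^ k = 1 := by
  rw [x_pow, gen_pow]; rfl

theorem mk_mul (u v p q : Alg k) :
    (⟨1, u, p⟩ : Model k) * ⟨1, v, q⟩ = ⟨1, u + v, p + q + u * swap k v⟩ := by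
  ext1 <;> simp

theorem mk_inv (u p : Alg k) : (⟨1, u, p⟩ : Model k)⁻¹ = ⟨1, u, p + u * swap k u⟩ := by
  ext1 <;> simp [CharTwo.neg_eq, CharTwo.sub_eq_add, add_comm]

theorem mk_sq (u p : Alg k) : (⟨1, u, p⟩ : Model k) ^ 2 = ⟨1, 0, u * swap k u⟩ := by
  rw [sq, mk_mul]
  ext1 <;> simp [CharTwo.add_self_eq_zero]

theorem conj_mk (g : Model k) (u p : Alg k) : g⁻¹ * (⟨1, u, p⟩ : Model k) * g =
    ⟨1, fst k g.top * u, fst k g.top * snd k g.top * p + fst k g.top * u * swap k g.mid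
      + g.mid * swap k (fst k g.top * u)⟩ := by
  rw [mul_assoc, inv_mul_eq_iff_eq_mul]
  ext1
  · simp
  · simp [add_comm]
  · simp only [mul_bot, map_one, one_mul, map_mul, swap_fst]
    linear_combination -(g.mid * snd k g.top * swap k u) * (CharTwo.two_eq_zero (R := Alg k))

theorem comm_mk_mk (u v p q : Alg k) : comm (⟨1, u, p⟩ : Model k) ⟨1, v, q⟩ =
    ⟨1, 0, u * swap k v + v * swap k u⟩ := by
  rw [comm, mul_assoc, mul_assoc, ← mul_assoc _ (⟨1, u, p⟩ : Model k), conj_mk, mk_inv, mk_mul]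
  ext1
  · rfl
  · simp [CharTwo.add_self_eq_zero]
  · simp only [map_one, one_mul]
    linear_combination (p + u * swap k u) * (CharTwo.two_eq_zero (R := Alg k))

/-- The commutator is the inverse times the conjugate by `x`. The inverse contributes `u * swap u`
and the cocycle contributes `t * (u * swap u)`; their sum is the correction with factor `T = t - 1`,
the source of `tailSeq`. -/
theorem comm_mk_x (u p : Alg k) : comm (⟨1, u, p⟩ : Model k) (x k) =
    ⟨1, Sv k * u, delta (Sv k) (Tv k) * p + Tv k * (u * swap k u)⟩ := by
  have hs : fst k (gen k) = 1 + Sv k := by rw [Sv]; ring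
  have ht : snd k (gen k) = 1 + Tv k := by rw [Tv]; ring
  rw [comm, mul_assoc, mul_assoc, ← mul_assoc _ (⟨1, u, p⟩ : Model k), conj_mk, mk_inv, mk_mul]
  ext1
  · rfl
  · simp only [x, hs]
    linear_combination u * (CharTwo.two_eq_zero (R := Alg k))
  · simp only [x, map_mul, map_zero, swap_fst]
    rw [hs, ht, delta]
    linear_combination (p + u * swap k u) * (CharTwo.two_eq_zero (R := Alg k))

theorem iterComm_bot_x (p : Alg k) (j : ℕ) : iterComm (⟨1, 0, p⟩ : Model k) (x k) j =
    ⟨1, 0, delta (Sv k) (Tv k) ^ j * p⟩ := by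
  unfold iterComm
  induction j with
  | zero => simp
  | succ j ih =>
    rw [Function.iterate_succ_apply', ih, comm_mk_x]
    simp [pow_succ', mul_assoc]

theorem iterComm_y_x (j : ℕ) : iterComm (y k) (x k) j =
    ⟨1, Sv k ^ j, tailSeq (Sv k) (Tv k) j⟩ := by
  unfold iterComm
  induction j with
  | zero => simp [y, tailSeq]
  | succ j ih =>
    rw [Function.iterate_succ_apply', ih, comm_mk_x, tailSeq, map_pow, swap_Sv, pow_succ']
    refine congrArg _ (congrArg _ ?_)
    rw [pow_succ', mul_left_comm]

theorem comm_iterComm_y (j : ℕ) : comm (iterComm (y k) (x k) j) (y k) =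
    ⟨1, 0, symm (Sv k) (Tv k) j 0⟩ := by
  rw [iterComm_y_x, y, comm_mk_mk, map_pow, swap_Sv, symm]
  simp

/-- The conjugate of the second generator by a power of the first. -/
theorem conj_y (j : ℕ) : (x k ^ j)⁻¹ * y k * x k ^ j = ⟨1, fst k (gen k ^ j), 0⟩ := by
  rw [y, conj_mk, x_pow]; simp

end Model

end Model

/-! ### Approximation in pro-2 completions -/

section Approximation

variable {Γ : Type} [Group Γ]

/-- The intersection of two normal subgroups whose indices are powers of two. -/
def TwoPowerNormal.inf (U V : TwoPowerNormal Γ) : TwoPowerNormal Γ where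
  toSubgroup := U.toSubgroup ⊓ V.toSubgroup
  normal := inferInstance
  index_eq := by
    obtain ⟨m, hm⟩ := U.index_eq
    obtain ⟨n, hn⟩ := V.index_eq
    have h1 : (U.toSubgroup ⊓ V.toSubgroup).relIndex V.toSubgroup ∣ 2 ^ m := by
      rw [Subgroup.inf_relIndex_right, ← hm]
      exact Subgroup.relIndex_dvd_index_of_normal _ _
    obtain ⟨l, -, hl⟩ := (Nat.dvd_prime_pow Nat.prime_two).1 h1
    refine ⟨l + n, ?_⟩
    rw [← Subgroup.relIndex_mul_index (inf_le_right : U.toSubgroup ⊓ V.toSubgroup ≤ V.toSubgroup),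
      hl, hn, pow_add]

/-- The whole group as a subgroup of index `1`. -/
def TwoPowerNormal.top (Γ : Type) [Group Γ] : TwoPowerNormal Γ where
  toSubgroup := ⊤
  normal := inferInstance
  index_eq := ⟨0, by simp⟩

theorem exists_twoPowerNormal_le (s : Finset (TwoPowerNormal Γ)) :
    ∃ V : TwoPowerNormal Γ, ∀ U ∈ s, V.toSubgroup ≤ U.toSubgroup := by
  classical
  induction s using Finset.induction_on with
  | empty => exact ⟨TwoPowerNormal.top Γ, by simp⟩
  | insert U s _ ih =>
    obtain ⟨V, hV⟩ := ih
    refine ⟨U.inf V, fun U' hU' => ?_⟩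
    rcases Finset.mem_insert.1 hU' with rfl | h
    · exact inf_le_left
    · exact inf_le_right.trans (hV U' h)

/-- Density of `Γ`: a representative at one level below all members of `s` serves for all of them.
-/
theorem exists_proj_eq (s : Finset (TwoPowerNormal Γ)) (z : ProTwoCompletion Γ) :
    ∃ w : Γ, ∀ U ∈ s, proj U (toCompletion Γ w) = proj U z := by
  obtain ⟨V, hV⟩ := exists_twoPowerNormal_le s
  obtain ⟨w, hw⟩ := QuotientGroup.mk_surjective (s := V.toSubgroup) (z.1 V)
  refine ⟨w, fun U hU => ?_⟩
  have h := z.2 V U (hV U hU)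
  change _ = z.1 U
  rw [← h, ← hw]
  rfl

/-- A basic neighbourhood in the inverse limit constrains only finitely many coordinates. -/
theorem mem_of_isClosed {Z : Set (ProTwoCompletion Γ)} (hZ : IsClosed Z) {z : ProTwoCompletion Γ}
    (h : ∀ s : Finset (TwoPowerNormal Γ), ∃ c ∈ Z, ∀ U ∈ s, proj U c = proj U z) : z ∈ Z := by
  rw [← hZ.closure_eq, mem_closure_iff]
  intro o ho hz
  obtain ⟨o', ho', rfl⟩ := isOpen_induced_iff.1 ho
  obtain ⟨I, u, hu, hI⟩ := isOpen_pi_iff.1 ho' z.1 hz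
  obtain ⟨c, hc, hcz⟩ := h I
  refine ⟨c, hI fun U hU => ?_, hc⟩
  have : c.1 U = z.1 U := hcz U hU
  rw [this]
  exact (hu U hU).2

theorem extend_eq_of_proj_eq {P : Type} [Group P] [Finite P] (hP : IsPGroup 2 P) (f : Γ →* P)
    {w z : ProTwoCompletion Γ} (h : proj (kerTwoPower hP f) w = proj (kerTwoPower hP f) z) :
    extend hP f w = extend hP f z := 
  congrArg (QuotientGroup.kerLift f) h

end Approximation

/-! ### Expansion in a group generated by commuting involutions -/

section Expansion

/-- The homomorphism from a cyclic group determined by the image of the generator. -/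
def cyc {Q : Type*} [Group Q] {m : ℕ} (u : Q) (h : u ^ m = 1) : C m →* Q :=
  AddMonoidHom.toMultiplicativeLeft (ZMod.lift m ⟨zmultiplesHom (Additive Q) (Additive.ofMul u), by
    simpa using congrArg Additive.ofMul h⟩)

theorem cyc_ofAdd_one {Q : Type*} [Group Q] {m : ℕ} (u : Q) (h : u ^ m = 1) :
    cyc u h (Multiplicative.ofAdd 1) = u := by
  have := ZMod.lift_coe m (⟨zmultiplesHom (Additive Q) (Additive.ofMul u), by
    simpa using congrArg Additive.ofMul h⟩ : {f : ℤ →+ Additive Q // f m = 0}) 1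
  rw [Int.cast_one] at this
  refine (congrArg Additive.toMul this).trans ?_
  simp

/-- The functions `χ i` read off exponents: `φ g` is the product of the `φ (S i)` raised to `χ i g`.
The map `φ` allows this to be used modulo a normal subgroup. -/
theorem eq_one_of_dual {K L ι : Type*} [Group K] [Group L] [Fintype ι] [DecidableEq ι]
    (φ : K →* L) (K' : Subgroup K) (S : ι → K) (hS : ∀ i, S i ∈ K')
    (hcomm : ∀ i j, φ (S i) * φ (S j) = φ (S j) * φ (S i)) (hsq : ∀ i, φ (S i) ^ 2 = 1)
    (χ : ι → K → ZMod 2) (hχ : ∀ i, ∀ g ∈ K', ∀ h ∈ K', χ i (g * h) = χ i g + χ i h)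
    (hdual : ∀ i j, χ i (S j) = if i = j then 1 else 0) {g : K}
    (hg : g ∈ Subgroup.closure (Set.range S)) (hg0 : ∀ i, χ i g = 0) : φ g = 1 := by
  have : IsMulCommutative (Subgroup.closure (Set.range (φ ∘ S))) :=
    Subgroup.isMulCommutative_closure (by
      rintro _ ⟨i, rfl⟩ _ ⟨j, rfl⟩
      exact hcomm i j)
  let _ : CommGroup (Subgroup.closure (Set.range (φ ∘ S))) :=
    { (inferInstance : Group (Subgroup.closure (Set.range (φ ∘ S)))) with
      mul_comm := fun u v => this.is_comm.comm u v }
  let u : ι → Subgroup.closure (Set.range (φ ∘ S)) :=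
    fun i => ⟨φ (S i), Subgroup.subset_closure ⟨i, rfl⟩⟩
  have hu : ∀ i, u i ^ 2 = 1 := fun i => Subtype.ext (hsq i)
  have hone : ∀ i, χ i 1 = 0 := fun i => by
    have := hχ i 1 K'.one_mem 1 K'.one_mem
    rwa [mul_one, left_eq_add] at this
  have key : g ∈ K' ∧ φ g = (∏ i, cyc (u i) (hu i) (Multiplicative.ofAdd (χ i g)) :
      Subgroup.closure (Set.range (φ ∘ S))) := by
    clear hg0
    induction hg using Subgroup.closure_induction with
    | mem g hg =>
      obtain ⟨j, rfl⟩ := hg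
      refine ⟨hS j, ?_⟩
      rw [Finset.prod_eq_single j]
      · rw [hdual, if_pos rfl, cyc_ofAdd_one]
      · intro i _ hij
        rw [hdual, if_neg hij, ofAdd_zero, map_one]
      · simp
    | one => exact ⟨K'.one_mem, by simp [hone]⟩
    | mul g h _ _ hg hh =>
      refine ⟨K'.mul_mem hg.1 hh.1, ?_⟩
      rw [map_mul, hg.2, hh.2, ← Subgroup.coe_mul, ← Finset.prod_mul_distrib]
      refine congrArg _ (Finset.prod_congr rfl fun i _ => ?_)
      rw [hχ i g hg.1 h hh.1, ofAdd_add, map_mul]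
    | inv g _ hg =>
      refine ⟨K'.inv_mem hg.1, ?_⟩
      rw [map_inv, hg.2, ← Subgroup.coe_inv, ← Finset.prod_inv_distrib]
      refine congrArg _ (Finset.prod_congr rfl fun i _ => ?_)
      have h := hχ i g hg.1 g⁻¹ (K'.inv_mem hg.1)
      rw [mul_inv_cancel, hone] at h
      rw [eq_neg_of_add_eq_zero_right h.symm, ofAdd_neg, map_inv]
  rw [key.2]
  simp [hg0]

end Expansion

/-! ### The homomorphism to the model -/

section ToModel

variable {k : ℕ}

/-- The continuous homomorphism from the free pro-`2` group to the model. -/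
def toModel (k : ℕ) : F₂ →* Model k :=
  extend (Model.isPGroup k) (FreeGroup.lift ![Model.x k, Model.y k])

theorem toModel_a : toModel k a = Model.x k := by
  simp [toModel, a, extend_toCompletion]

theorem toModel_b : toModel k b = Model.y k := by
  simp [toModel, b, extend_toCompletion]

theorem isClosed_ker_toModel : IsClosed ((toModel k).ker : Set F₂) := by
  let _ : TopologicalSpace (Model k) := ⊥
  have : DiscreteTopology (Model k) := ⟨rfl⟩
  exact (isClosed_discrete {(1 : Model k)}).preimage
    (continuous_extend (Model.isPGroup k) (FreeGroup.lift ![Model.x k, Model.y k]))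

/-- The element of the group algebra that corresponds to an element of the base group. -/
def lin (f : C (2 ^ k) → C 2) : Alg k :=
  ∑ z, MonoidAlgebra.single (z⁻¹, 1) (Multiplicative.toAdd (f z))

theorem lin_one : lin (1 : C (2 ^ k) → C 2) = 0 := by
  simp [lin]

theorem lin_mul (f g : C (2 ^ k) → C 2) : lin (f * g) = lin f + lin g := by
  simp only [lin, Pi.mul_apply, toAdd_mul, MonoidAlgebra.single_add, Finset.sum_add_distrib]

theorem lin_shift (f : C (2 ^ k) → C 2) (q : C (2 ^ k)) :
    lin (fun z => f (q * z)) = fst k q * lin f := by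
  simp only [lin, Finset.mul_sum, fst_eq_single, MonoidAlgebra.single_mul_single, one_mul]
  refine Fintype.sum_equiv (Equiv.mulLeft q) _ _ fun z => ?_
  simp

theorem fst_mul_fst_inv (q : C (2 ^ k)) : fst k q * fst k q⁻¹ = 1 := by
  rw [← map_mul, mul_inv_cancel, map_one]

/-- The wreath product writes the base part before the top part and the model after it; the factor
`fst k` of the top part converts one form into the other. -/
theorem lift_model_eq (w : FreeGroup (Fin 2)) :
    (FreeGroup.lift ![Model.x k, Model.y k] w).top = (FreeGroup.lift ![xW k, yW k] w).right ∧
    (FreeGroup.lift ![Model.x k, Model.y k] w).mid = fst k (FreeGroup.lift ![xW k, yW k] w).right *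
      lin (FreeGroup.lift ![xW k, yW k] w).left := by
  have hinv : ∀ (g : Model k) (h : W k), g.top = h.right ∧ g.mid = fst k h.right * lin h.left →
      (g⁻¹).top = (h⁻¹).right ∧ (g⁻¹).mid = fst k (h⁻¹).right * lin (h⁻¹).left := by
    rintro g h ⟨h1, h2⟩
    refine ⟨by simp [h1], ?_⟩
    have h3 : lin (h.left⁻¹) = - lin h.left := by
      rw [eq_neg_iff_add_eq_zero, ← lin_mul, inv_mul_cancel, lin_one]
    rw [Model.inv_mid, h1, h2, RegularWreathProduct.inv_right, RegularWreathProduct.inv_left,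
      lin_shift, h3]
    ring
  induction w using FreeGroup.induction_on with
  | C1 => simp [lin_one]
  | of i =>
    rw [FreeGroup.lift_apply_of, FreeGroup.lift_apply_of]
    fin_cases i
    · simp [Model.x, xW, gen, lin_one]
    · simp only [Model.y, yW, Fin.mk_one, Matrix.cons_val_one, Matrix.cons_val_fin_one, map_one,
        one_mul, true_and]
      rw [lin, Finset.sum_eq_single 1]
      · simp [MonoidAlgebra.one_def, Prod.one_eq_mk]
      · intro z _ hz
        simp [hz]
      · simp
  | inv_of i h => rw [map_inv, map_inv]; exact hinv _ _ h
  | mul v w hv hw =>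
    rw [map_mul, map_mul]
    refine ⟨by simp [hv.1, hw.1], ?_⟩
    rw [Model.mul_mid, hv.2, hw.2, hw.1, RegularWreathProduct.mul_right,
      RegularWreathProduct.mul_left, lin_mul, lin_shift, map_mul]
    linear_combination -(fst k (FreeGroup.lift ![xW k, yW k] w).right *
      lin (FreeGroup.lift ![xW k, yW k] w).left) *
        fst_mul_fst_inv (FreeGroup.lift ![xW k, yW k] v).right

theorem toModel_eq (z : F₂) : (toModel k z).top = (toW k z).right ∧
    (toModel k z).mid = fst k (toW k z).right * lin (toW k z).left := by
  classical
  obtain ⟨w, hw⟩ := exists_proj_eq {kerTwoPower (Model.isPGroup k)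
    (FreeGroup.lift ![Model.x k, Model.y k]), kerTwoPower (isPGroup_W k)
    (FreeGroup.lift ![xW k, yW k])} z
  have h1 : toModel k (toCompletion _ w) = toModel k z :=
    extend_eq_of_proj_eq _ _ (hw _ (by simp))
  have h2 : toW k (toCompletion _ w) = toW k z :=
    extend_eq_of_proj_eq _ _ (hw _ (by simp))
  rw [← h1, ← h2]
  exact lift_model_eq w

theorem toModel_of_mem_Y {z : F₂} (hz : z ∈ Y k) : ∃ v p, toModel k z = ⟨1, v, p⟩ := by
  have h : (toW k z).right = 1 := hz
  exact ⟨_, _, Model.ext ((toModel_eq z).1.trans h) rfl rfl⟩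

theorem toModel_of_mem_R {z : F₂} (hz : z ∈ R k) : ∃ p, toModel k z = ⟨1, 0, p⟩ := by
  have h : toW k z = 1 := hz
  refine ⟨_, Model.ext ((toModel_eq z).1.trans (by rw [h]; rfl)) ?_ rfl⟩
  rw [(toModel_eq z).2, h, RegularWreathProduct.one_left, lin_one, mul_zero]

/-- Elements of `R k` go to the bottom of the model, which has exponent two and commutes with
everything of trivial top coordinate, in particular with the image of `Y k`. Closedness of the
kernel takes care of the topological closure. -/
theorem N_le_ker : N k ≤ (toModel k).ker := by
  refine Subgroup.topologicalClosure_minimal _ (sup_le (sup_le ?_ ?_) ?_) isClosed_ker_toModel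
  · rw [Subgroup.commutator_le]
    intro r hr z hz
    obtain ⟨p, hp⟩ := toModel_of_mem_R hr
    obtain ⟨v, q, hq⟩ := toModel_of_mem_Y hz
    rw [MonoidHom.mem_ker, map_commutatorElement, commutatorElement_eq_one_iff_mul_comm, hp, hq,
      Model.mk_mul, Model.mk_mul]
    simp [add_comm]
  · refine (Subgroup.closure_le _).2 ?_
    rintro _ ⟨r, hr, rfl⟩
    obtain ⟨p, hp⟩ := toModel_of_mem_R hr
    rw [SetLike.mem_coe, MonoidHom.mem_ker, map_pow, hp, Model.mk_sq]
    simp only [zero_mul]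
    rfl
  · refine Subgroup.normalClosure_le_normal ?_
    rw [Set.singleton_subset_iff, SetLike.mem_coe, MonoidHom.mem_ker, map_pow, toModel_a,
      Model.x_pow_two_pow]

/-- The homomorphism from `G_k` to the model. -/
def model (k : ℕ) : G k →* Model k := QuotientGroup.lift (N k) (toModel k) N_le_ker

theorem model_x : model k (x k) = Model.x k := toModel_a

theorem model_y : model k (y k) = Model.y k := toModel_b

end ToModel

/-! ### Faithfulness of the model -/

section Faithful

/-- The conjugate of `Y` by the power `X ^ j`. -/
def conjPow {K : Type*} [Group K] (X Y : K) (j : ℤ) : K := (X ^ j)⁻¹ * Y * X ^ j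

variable {K : Type} [Group K] {X Y : K} {k : ℕ}

theorem conj_conjPow (i j : ℤ) : (X ^ i)⁻¹ * conjPow X Y j * X ^ i = conjPow X Y (j + i) := by
  rw [conjPow, conjPow, zpow_add]; group

theorem conjPow_zero : conjPow X Y 0 = Y := by simp [conjPow]

theorem conjPow_eq_of_pow_eq_one (hX : X ^ 2 ^ k = 1) (j : ℤ) :
    ∃ i : Fin (2 ^ k), conjPow X Y j = conjPow X Y i := by
  have hpos : (0 : ℤ) < ((2 ^ k : ℕ) : ℤ) := by positivity
  have h0 := Int.emod_nonneg j hpos.ne'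
  have h1 := Int.emod_lt_of_pos j hpos
  refine ⟨⟨(j % ((2 ^ k : ℕ) : ℤ)).toNat, by omega⟩, ?_⟩
  have h2 : X ^ j = X ^ (j % ((2 ^ k : ℕ) : ℤ)) := by
    conv_lhs => rw [← Int.emod_add_mul_ediv j ((2 ^ k : ℕ) : ℤ)]
    rw [zpow_add, zpow_mul, zpow_natCast, hX, one_zpow, mul_one]
  simp only [conjPow]
  rw [Int.toNat_of_nonneg h0, h2]

/-- The subgroup generated by the conjugates of `Y` under powers of `X`. -/
def conjSpan (X Y : K) : Subgroup K := Subgroup.closure (Set.range (conjPow X Y))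

theorem conj_mem_conjSpan {h : K} (hh : h ∈ conjSpan X Y) (i : ℤ) :
    (X ^ i)⁻¹ * h * X ^ i ∈ conjSpan X Y := by
  induction hh using Subgroup.closure_induction with
  | mem h hh =>
    obtain ⟨j, rfl⟩ := hh
    rw [conj_conjPow]
    exact Subgroup.subset_closure ⟨_, rfl⟩
  | one => simp
  | mul g h _ _ hg hh =>
    convert mul_mem hg hh using 1
    group
  | inv g _ hg =>
    convert inv_mem hg using 1
    group

theorem exists_zpow_mul {g : K} (hg : g ∈ Subgroup.closure {X, Y}) :
    ∃ i : ℤ, ∃ h ∈ conjSpan X Y, g = X ^ i * h := by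
  induction hg using Subgroup.closure_induction with
  | mem g hg =>
    rcases hg with rfl | rfl
    · exact ⟨1, 1, one_mem _, by simp⟩
    · exact ⟨0, g, Subgroup.subset_closure ⟨0, conjPow_zero⟩, by simp⟩
  | one => exact ⟨0, 1, one_mem _, by simp⟩
  | mul g h _ _ hg hh =>
    obtain ⟨i, u, hu, rfl⟩ := hg
    obtain ⟨j, v, hv, rfl⟩ := hh
    refine ⟨i + j, _, mul_mem (conj_mem_conjSpan hu j) hv, ?_⟩
    rw [zpow_add]; group
  | inv g _ hg =>
    obtain ⟨i, u, hu, rfl⟩ := hg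
    refine ⟨-i, _, conj_mem_conjSpan (inv_mem hu) (-i), ?_⟩
    group

/-- The squares and commutators of the conjugates of `Y` under powers of `X`. -/
def relators (X Y : K) : Set K :=
  {g | ∃ j : ℤ, g = conjPow X Y j ^ 2} ∪ {g | ∃ i j : ℤ, g = comm (conjPow X Y i) (conjPow X Y j)}

theorem conj_comm (g h l : K) : l⁻¹ * comm g h * l = comm (l⁻¹ * g * l) (l⁻¹ * h * l) := by
  unfold comm; group

theorem conj_mem_closure_relators {h : K} (hh : h ∈ Subgroup.closure (relators X Y)) (i : ℤ) :
    (X ^ i)⁻¹ * h * X ^ i ∈ Subgroup.closure (relators X Y) := by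
  induction hh using Subgroup.closure_induction with
  | mem h hh =>
    refine Subgroup.subset_closure ?_
    rcases hh with ⟨j, rfl⟩ | ⟨j, l, rfl⟩
    · refine Or.inl ⟨j + i, ?_⟩
      rw [← conj_conjPow, sq, sq]; group
    · refine Or.inr ⟨j + i, l + i, ?_⟩
      rw [conj_comm, conj_conjPow, conj_conjPow]
  | one => simp
  | mul g h _ _ hg hh =>
    convert mul_mem hg hh using 1
    group
  | inv g _ hg =>
    convert inv_mem hg using 1
    group

/-- Conjugation by `X` permutes the relators, and `Y` commutes with them. -/
theorem normal_closure_relators (hgen : Subgroup.closure {X, Y} = ⊤)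
    (hcomm : ∀ g ∈ Subgroup.closure (relators X Y), g * Y = Y * g) :
    (Subgroup.closure (relators X Y)).Normal := by
  rw [← Subgroup.normalizer_eq_top_iff, eq_top_iff, ← hgen, Subgroup.closure_le]
  rintro g (rfl | rfl)
  · rw [SetLike.mem_coe, Subgroup.mem_normalizer_iff]
    intro h
    constructor
    · intro hh
      simpa using conj_mem_closure_relators hh (-1)
    · intro hh
      simpa [mul_assoc] using conj_mem_closure_relators hh 1
  · rw [SetLike.mem_coe, Subgroup.mem_normalizer_iff]
    intro h
    constructor
    · intro hh
      rwa [← hcomm h hh, mul_inv_cancel_right]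
    · intro hh
      have := hcomm _ hh
      have h2 : g * h * g⁻¹ = h := by
        rw [inv_mul_cancel_right] at this
        exact (mul_left_cancel this).symm
      rwa [h2] at hh

theorem gen_pow_inj {i j : Fin (2 ^ k)} : gen k ^ (i : ℕ) = gen k ^ (j : ℕ) ↔ i = j := by
  refine ⟨fun h => ?_, fun h => by rw [h]⟩
  rw [gen, ← ofAdd_nsmul, ← ofAdd_nsmul, nsmul_one, nsmul_one] at h
  have h1 := (ZMod.natCast_eq_natCast_iff' _ _ _).1 (Multiplicative.ofAdd.injective h)
  rw [Nat.mod_eq_of_lt i.2, Nat.mod_eq_of_lt j.2] at h1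
  exact Fin.ext h1

theorem model_conjPow {F : K →* Model k} (hFX : F X = Model.x k) (hFY : F Y = Model.y k)
    (j : ℕ) : F (conjPow X Y j) = ⟨1, fst k (gen k ^ j), 0⟩ := by
  rw [conjPow, map_mul, map_mul, map_inv, map_zpow, hFX, hFY, zpow_natCast, Model.conj_y]

theorem coeff_fst (i j : Fin (2 ^ k)) :
    (fst k (gen k ^ (j : ℕ))).coeff (gen k ^ (i : ℕ), 1) = if i = j then (1 : ZMod 2) else 0 := by
  rw [fst_eq_single, MonoidAlgebra.coeff_single, Finsupp.single_apply]
  simp only [Prod.mk.injEq, and_true, gen_pow_inj, eq_comm (a := i)]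

theorem coeff_fst_mul_snd (i i' j j' : Fin (2 ^ k)) :
    (fst k (gen k ^ (j : ℕ)) * snd k (gen k ^ (j' : ℕ))).coeff (gen k ^ (i : ℕ), gen k ^ (i' : ℕ)) =
      if i = j ∧ i' = j' then (1 : ZMod 2) else 0 := by
  rw [fst_mul_snd, MonoidAlgebra.coeff_single, Finsupp.single_apply]
  simp only [Prod.mk.injEq, gen_pow_inj, eq_comm (a := i), eq_comm (a := i')]

/-- The elements of trivial top coordinate. -/
def topKer (F : K →* Model k) : Subgroup K where
  carrier := {g | (F g).top = 1}
  mul_mem' {g h} hg hh := by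
    rw [Set.mem_ofPred_eq] at hg hh ⊢
    rw [map_mul, Model.mul_top, hg, hh, one_mul]
  one_mem' := by simp
  inv_mem' {g} hg := by
    rw [Set.mem_ofPred_eq] at hg ⊢
    rw [map_inv, Model.inv_top, hg, inv_one]

/-- The elements of trivial top and middle coordinates. -/
def midKer (F : K →* Model k) : Subgroup K where
  carrier := {g | (F g).top = 1 ∧ (F g).mid = 0}
  mul_mem' {g h} hg hh := by
    rw [Set.mem_ofPred_eq] at hg hh ⊢
    simp [hg, hh]
  one_mem' := by simp
  inv_mem' {g} hg := by
    rw [Set.mem_ofPred_eq] at hg ⊢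
    simp [hg]

/-- Here `Z` and `H` play the roles of the images of `R k` and `Y k`. The three coordinates are used
in turn: the top one removes the power of `X`, the middle one puts the rest into the span `P` of the
relators, and the bottom one shows that it is trivial. -/
theorem model_faithful (hgen : Subgroup.closure {X, Y} = ⊤) (hX : X ^ 2 ^ k = 1)
    (Z H : Subgroup K) (hZH : ∀ z ∈ Z, ∀ h ∈ H, z * h = h * z) (hle : Z ≤ H)
    (hZ : ∀ z ∈ Z, z ^ 2 = 1) (hYH : ∀ j : ℤ, conjPow X Y j ∈ H) (hrel : relators X Y ⊆ Z)
    {F : K →* Model k} (hFX : F X = Model.x k) (hFY : F Y = Model.y k) {g : K} (hg : F g = 1) :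
    g = 1 := by
  set P := Subgroup.closure (relators X Y) with hP
  have hPZ : P ≤ Z := (Subgroup.closure_le _).2 hrel
  have hPn : P.Normal := normal_closure_relators hgen fun u hu =>
    hZH u (hPZ hu) Y (by simpa [conjPow_zero] using hYH 0)
  -- reduction to the span of the conjugates
  obtain ⟨i, h, hh, rfl⟩ := exists_zpow_mul (hgen ▸ Subgroup.mem_top g)
  have htop : ∀ u ∈ conjSpan X Y, (F u).top = 1 := by
    intro u hu
    have : conjSpan X Y ≤ topKer F := by
      refine (Subgroup.closure_le _).2 ?_
      rintro _ ⟨j, rfl⟩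
      obtain ⟨i, hi⟩ := conjPow_eq_of_pow_eq_one (Y := Y) hX j
      change (F _).top = 1
      rw [hi, model_conjPow hFX hFY]
    exact this hu
  have hXi : X ^ i = 1 := by
    have h1 : (F X) ^ i * F h = 1 := by rw [← map_zpow, ← map_mul, hg]
    have hpos : (0 : ℤ) < ((2 ^ k : ℕ) : ℤ) := by positivity
    have h0 := Int.emod_nonneg i hpos.ne'
    have h3 := Int.emod_lt_of_pos i hpos
    have h2 : ∀ (U : Type) [Group U] (u : U), u ^ 2 ^ k = 1 →
        u ^ i = u ^ (i % ((2 ^ k : ℕ) : ℤ)).toNat := by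
      intro U _ u hu
      rw [← zpow_natCast u, Int.toNat_of_nonneg h0]
      conv_lhs => rw [← Int.emod_add_mul_ediv i ((2 ^ k : ℕ) : ℤ)]
      rw [zpow_add, zpow_mul, zpow_natCast, hu, one_zpow, mul_one]
    rw [hFX, h2 _ _ Model.x_pow_two_pow, Model.x_pow] at h1
    have h4 := congrArg Model.top h1
    rw [Model.mul_top, htop h hh, mul_one, Model.one_top] at h4
    have h5 := (gen_pow_inj (k := k) (i := ⟨(i % ((2 ^ k : ℕ) : ℤ)).toNat, by omega⟩)
      (j := ⟨0, by positivity⟩)).1 (by rw [pow_zero]; exact h4)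
    rw [h2 _ _ hX, show (i % ((2 ^ k : ℕ) : ℤ)).toNat = 0 from congrArg Fin.val h5, pow_zero]
  rw [hXi, one_mul] at hg ⊢
  -- reduction to the span of the relators
  have hfin : conjSpan X Y =
      Subgroup.closure (Set.range fun i : Fin (2 ^ k) => conjPow X Y (i : ℕ)) := by
    refine le_antisymm ((Subgroup.closure_le _).2 ?_) (Subgroup.closure_mono ?_)
    · rintro _ ⟨j, rfl⟩
      obtain ⟨i, hi⟩ := conjPow_eq_of_pow_eq_one (Y := Y) hX j
      exact Subgroup.subset_closure ⟨i, hi.symm⟩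
    · rintro _ ⟨j, rfl⟩
      exact ⟨_, rfl⟩
  have hmemP : h ∈ P := by
    rw [hfin] at hh
    rw [← QuotientGroup.eq_one_iff]
    -- Modulo `P` the conjugates of `Y` are commuting involutions, dual to the coefficients of the
    -- middle coordinate.
    refine eq_one_of_dual (QuotientGroup.mk' P) (topKer F) (fun i : Fin (2 ^ k) => conjPow X Y (i : ℕ))
      ?_ ?_ ?_ (fun i g => (F g).mid.coeff (gen k ^ (i : ℕ), 1)) ?_ ?_ hh ?_
    · intro i
      change (F _).top = 1
      rw [model_conjPow hFX hFY]
    · intro i j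
      rw [← map_mul, ← map_mul]
      refine (QuotientGroup.eq.2 ?_).symm
      refine Subgroup.subset_closure (Or.inr ⟨i, j, ?_⟩)
      rw [comm]; group
    · intro i
      rw [← map_pow]
      exact (QuotientGroup.eq_one_iff _).2 (Subgroup.subset_closure (Or.inl ⟨i, rfl⟩))
    · intro i g _ h hh
      have hh : (F h).top = 1 := hh
      simp [hh]
    · intro i j
      rw [model_conjPow hFX hFY]
      exact coeff_fst i j
    · intro i
      rw [hg]; rfl
  -- the span of the relators
  let ι : Type := {e : Fin (2 ^ k) × Fin (2 ^ k) // e.1 ≤ e.2}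
  let S : ι → K := fun e => if e.1.1 = e.1.2 then conjPow X Y (e.1.1 : ℕ) ^ 2 else
    comm (conjPow X Y (e.1.1 : ℕ)) (conjPow X Y (e.1.2 : ℕ))
  have hSrel : ∀ e, S e ∈ Z := by
    intro e
    by_cases he : e.1.1 = e.1.2
    · simp only [S, if_pos he]
      exact hrel (Or.inl ⟨_, rfl⟩)
    · simp only [S, if_neg he]
      exact hrel (Or.inr ⟨_, _, rfl⟩)
  have hFS : ∀ e, F (S e) = ⟨1, 0, if e.1.1 = e.1.2 then
      fst k (gen k ^ (e.1.1 : ℕ)) * snd k (gen k ^ (e.1.1 : ℕ)) else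
      fst k (gen k ^ (e.1.1 : ℕ)) * snd k (gen k ^ (e.1.2 : ℕ)) +
      fst k (gen k ^ (e.1.2 : ℕ)) * snd k (gen k ^ (e.1.1 : ℕ))⟩ := by
    intro e
    by_cases he : e.1.1 = e.1.2
    · simp only [S, if_pos he]
      rw [map_pow, model_conjPow hFX hFY, Model.mk_sq, swap_fst]
    · simp only [S, if_neg he]
      have : F (comm (conjPow X Y (e.1.1 : ℕ)) (conjPow X Y (e.1.2 : ℕ))) =
        comm (F (conjPow X Y (e.1.1 : ℕ))) (F (conjPow X Y (e.1.2 : ℕ))) := by simp [comm]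
      rw [this, model_conjPow hFX hFY, model_conjPow hFX hFY, Model.comm_mk_mk, swap_fst, swap_fst]
  have hPS : P ≤ Subgroup.closure (Set.range S) := by
    refine (Subgroup.closure_le _).2 ?_
    rintro u (⟨j, rfl⟩ | ⟨i, j, rfl⟩)
    · obtain ⟨i, hi⟩ := conjPow_eq_of_pow_eq_one (Y := Y) hX j
      rw [hi]
      exact Subgroup.subset_closure ⟨⟨(i, i), le_rfl⟩, by simp [S]⟩
    · obtain ⟨i, hi⟩ := conjPow_eq_of_pow_eq_one (Y := Y) hX i
      obtain ⟨j, hj⟩ := conjPow_eq_of_pow_eq_one (Y := Y) hX j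
      rw [hi, hj]
      rcases lt_trichotomy i j with hij | rfl | hij
      · exact Subgroup.subset_closure ⟨⟨(i, j), hij.le⟩, by simp [S, hij.ne]⟩
      · simp [comm]
      · have : comm (conjPow X Y (i : ℕ)) (conjPow X Y (j : ℕ)) =
            (comm (conjPow X Y (j : ℕ)) (conjPow X Y (i : ℕ)))⁻¹ := by
          unfold comm; group
        rw [this]
        exact inv_mem (Subgroup.subset_closure ⟨⟨(j, i), hij.le⟩, by simp [S, hij.ne]⟩)
  -- The bottom coordinates of the relators are symmetric, so the coefficients at pairs `i ≤ i'`
  -- suffice, and each relator in `S` meets exactly one such pair.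
  refine eq_one_of_dual (MonoidHom.id K) (midKer F) S ?_ ?_ ?_
    (fun e g => (F g).bot.coeff (gen k ^ (e.1.1 : ℕ), gen k ^ (e.1.2 : ℕ))) ?_ ?_ (hPS hmemP) ?_
  · intro e
    change (F _).top = 1 ∧ (F _).mid = 0
    rw [hFS]
    exact ⟨rfl, rfl⟩
  · intro e f
    exact hZH _ (hSrel e) _ (hle (hSrel f))
  · intro e
    exact hZ _ (hSrel e)
  · intro e g hg h hh
    have hg : (F g).top = 1 ∧ (F g).mid = 0 := hg
    have hh : (F h).top = 1 ∧ (F h).mid = 0 := hh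
    simp [hg, hh]
  · rintro ⟨⟨i, i'⟩, hi⟩ ⟨⟨j, j'⟩, hj⟩
    simp only at hi hj
    have hiff : i = j ∧ i' = j' ↔ (⟨(i, i'), hi⟩ : ι) = ⟨(j, j'), hj⟩ := by
      refine Iff.trans ?_ Subtype.ext_iff.symm
      exact Prod.mk_inj.symm
    refine Eq.trans ?_ (if_congr hiff rfl rfl)
    rw [hFS]
    by_cases hjj : j = j'
    · subst hjj
      simp only [if_true]
      rw [coeff_fst_mul_snd]
    · simp only [if_neg hjj]
      rw [MonoidAlgebra.coeff_add, Finsupp.add_apply, coeff_fst_mul_snd,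
        coeff_fst_mul_snd, if_neg (c := i = j' ∧ i' = j), add_zero]
      rintro ⟨rfl, rfl⟩
      exact hjj (le_antisymm hj hi)
  · intro e
    rw [hg]; rfl

end Faithful

/-! ### Embedding of `G k` in the model -/

section Embedding

open scoped commutatorElement

variable {k : ℕ}

theorem mul_self_of_mem_B {g : W k} (hg : g ∈ B k) : g ^ 2 = 1 := by
  have h : g.right = 1 := hg
  have h2 : ∀ u : C 2, u * u = 1 := by decide
  rw [sq]
  ext1
  · funext z
    simp [h, h2]
  · simp [h]

theorem mul_comm_of_mem_B {g h : W k} (hg : g ∈ B k) (hh : h ∈ B k) : g * h = h * g := by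
  have h1 : g.right = 1 := hg
  have h2 : h.right = 1 := hh
  ext1
  · funext z
    simp [h1, h2, mul_comm]
  · simp [h1, h2]

instance : (B k).Normal := by unfold B; infer_instance

theorem toW_conjPow_mem (j : ℤ) : toW k (conjPow a b j) ∈ B k := by
  have h : toW k b ∈ B k := by rw [toW_b]; rfl
  rw [conjPow, map_mul, map_mul, map_inv]
  have := (inferInstance : (B k).Normal).conj_mem _ h (toW k (a ^ j))⁻¹
  rwa [inv_inv] at this

theorem map_comm {Γ Δ : Type} [Group Γ] [Group Δ] (f : Γ →* Δ) (g h : Γ) :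
    f (comm g h) = comm (f g) (f h) := by simp [comm]

theorem map_conjPow {Γ Δ : Type} [Group Γ] [Group Δ] (f : Γ →* Δ) (g h : Γ) (j : ℤ) :
    f (conjPow g h j) = conjPow (f g) (f h) j := by simp [conjPow]

theorem mk_eq_one_of_mem {u : F₂}
    (h : u ∈ ⁅R k, Y k⁆ ⊔ squaresR k ⊔ Subgroup.normalClosure {a ^ 2 ^ k}) :
    (QuotientGroup.mk u : G k) = 1 :=
  (QuotientGroup.eq_one_iff u).2 (Subgroup.le_topologicalClosure _ h)

theorem x_pow_two_pow : x k ^ 2 ^ k = 1 :=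
  mk_eq_one_of_mem (le_sup_right (a := ⁅R k, Y k⁆ ⊔ squaresR k)
    (Subgroup.subset_normalClosure (Set.mem_singleton _)))

theorem mk_mul_comm {r u : F₂} (hr : r ∈ R k) (hu : u ∈ Y k) :
    (QuotientGroup.mk r : G k) * QuotientGroup.mk u = QuotientGroup.mk u * QuotientGroup.mk r := by
  have h : (QuotientGroup.mk ⁅r, u⁆ : G k) = 1 := mk_eq_one_of_mem
    ((le_sup_left.trans le_sup_left : ⁅R k, Y k⁆ ≤ _) (Subgroup.commutator_mem_commutator hr hu))
  exact commutatorElement_eq_one_iff_mul_comm.1 h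

theorem mk_sq {r : F₂} (hr : r ∈ R k) : (QuotientGroup.mk r : G k) ^ 2 = 1 :=
  mk_eq_one_of_mem ((le_sup_right.trans le_sup_left : squaresR k ≤ _)
    (Subgroup.subset_closure ⟨r, hr, rfl⟩))

/-- `model_faithful` is applied to the abstract subgroup generated by `x k` and `y k`, which at this
stage is not yet known to be the whole group. -/
theorem eq_one_of_model_eq_one_of_mem_closure {g : G k}
    (hg : g ∈ Subgroup.closure {x k, y k}) (h : model k g = 1) : g = 1 := by
  set D : Subgroup (G k) := Subgroup.closure {x k, y k} with hD
  let X : D := ⟨x k, Subgroup.subset_closure (by simp)⟩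
  let U : D := ⟨y k, Subgroup.subset_closure (by simp)⟩
  let π : F₂ →* G k := QuotientGroup.mk' (N k)
  have hYU : ∀ j, D.subtype (conjPow X U j) = π (conjPow a b j) := by
    intro j
    rw [map_conjPow, map_conjPow]; rfl
  have key : (⟨g, hg⟩ : D) = 1 := by
    refine model_faithful (X := X) (Y := U) (k := k) ?_ (Subtype.ext x_pow_two_pow)
      (((R k).map π).comap D.subtype) (((Y k).map π).comap D.subtype) ?_ ?_ ?_ ?_ ?_
      (F := (model k).comp D.subtype) model_x model_y h
    · have := Subgroup.closure_closure_coe_preimage (k := ({x k, y k} : Set (G k)))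
      rw [← this]
      congr 1
      ext u
      simp only [Set.mem_insert_iff, Set.mem_singleton_iff, Set.mem_preimage, X, U, Subtype.ext_iff]
    · rintro z ⟨r, hr, hrz⟩ u ⟨v, hv, hvu⟩
      refine Subtype.ext ?_
      change D.subtype z * D.subtype u = D.subtype u * D.subtype z
      rw [← hrz, ← hvu]
      exact mk_mul_comm hr hv
    · refine Subgroup.comap_mono (Subgroup.map_mono fun r hr => ?_)
      have hr : toW k r = 1 := hr
      change toW k r ∈ B k
      rw [hr]
      exact one_mem _
    · rintro z ⟨r, hr, hrz⟩
      refine Subtype.ext ?_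
      change D.subtype z ^ 2 = 1
      rw [← hrz]
      exact mk_sq hr
    · intro j
      exact ⟨conjPow a b j, toW_conjPow_mem j, (hYU j).symm⟩
    · rintro _ (⟨j, rfl⟩ | ⟨i, j, rfl⟩)
      · refine ⟨conjPow a b j ^ 2, ?_, ?_⟩
        · change toW k _ = 1
          rw [map_pow]
          exact mul_self_of_mem_B (toW_conjPow_mem j)
        · rw [map_pow, map_pow, hYU]
      · refine ⟨comm (conjPow a b i) (conjPow a b j), ?_, ?_⟩
        · change toW k _ = 1
          rw [map_comm, comm, mul_assoc, mul_assoc,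
            mul_comm_of_mem_B (toW_conjPow_mem i) (toW_conjPow_mem j)]
          group
        · rw [map_comm, map_comm, hYU, hYU]
  exact congrArg Subtype.val key

theorem mk_toCompletion_mem (w : FreeGroup (Fin 2)) :
    (QuotientGroup.mk (toCompletion _ w) : G k) ∈ Subgroup.closure {x k, y k} := by
  let f : FreeGroup (Fin 2) →* G k := (QuotientGroup.mk' (N k)).comp (toCompletion _)
  change f w ∈ _
  induction w using FreeGroup.induction_on with
  | C1 => rw [map_one]; exact one_mem _
  | of i =>
    refine Subgroup.subset_closure ?_
    fin_cases i
    · exact Or.inl rfl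
    · exact Or.inr rfl
  | inv_of i h => rw [map_inv]; exact inv_mem h
  | mul v w hv hw => rw [map_mul]; exact mul_mem hv hw

/-- Approximate an element of the kernel by words with the same image in the model. These words lie
in `N k` by the previous case, and `N k` is closed. -/
theorem model_injective : Function.Injective (model k) := by
  classical
  rw [injective_iff_map_eq_one]
  intro g hg
  obtain ⟨z, rfl⟩ := QuotientGroup.mk_surjective g
  rw [QuotientGroup.eq_one_iff]
  refine mem_of_isClosed (Z := (N k : Set F₂)) (Subgroup.isClosed_topologicalClosure _) fun s => ?_
  obtain ⟨w, hw⟩ := exists_proj_eq (insert (kerTwoPower (Model.isPGroup k)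
    (FreeGroup.lift ![Model.x k, Model.y k])) s) z
  refine ⟨toCompletion _ w, ?_, fun U hU => hw U (Finset.mem_insert_of_mem hU)⟩
  refine (QuotientGroup.eq_one_iff _).1
    (eq_one_of_model_eq_one_of_mem_closure (mk_toCompletion_mem w) ?_)
  rw [← hg]
  exact extend_eq_of_proj_eq (Model.isPGroup k) _ (hw _ (Finset.mem_insert_self _ _))

/-- By injectivity, a word that approximates an element well enough to agree with it in the finite
model equals it in `G k`. -/
theorem closure_x_y : Subgroup.closure {x k, y k} = (⊤ : Subgroup (G k)) := by
  rw [eq_top_iff]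
  intro g _
  obtain ⟨z, rfl⟩ := QuotientGroup.mk_surjective g
  obtain ⟨w, hw⟩ := exists_proj_eq {kerTwoPower (Model.isPGroup k)
    (FreeGroup.lift ![Model.x k, Model.y k])} z
  have : (QuotientGroup.mk z : G k) = QuotientGroup.mk (toCompletion _ w) :=
    model_injective (extend_eq_of_proj_eq (Model.isPGroup k) _
      (hw _ (Finset.mem_singleton_self _))).symm
  rw [this]
  exact mk_toCompletion_mem w

instance : Finite (G k) := Finite.of_injective _ (model_injective (k := k))

theorem isPGroup_G (k : ℕ) : IsPGroup 2 (G k) := (Model.isPGroup k).of_injective _ model_injective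

/-! ### A lower bound for the order -/

theorem model_conj_y (j : ℕ) : model k ((x k ^ j)⁻¹ * y k * x k ^ j) = ⟨1, fst k (gen k ^ j), 0⟩ := by
  rw [map_mul, map_mul, map_inv, map_pow, model_x, model_y, Model.conj_y]

theorem exists_gen_pow (q : C (2 ^ k)) : ∃ j : ℕ, q = gen k ^ j := by
  refine ⟨(Multiplicative.toAdd q).val, ?_⟩
  rw [gen, ← ofAdd_nsmul, nsmul_one, ZMod.natCast_zmod_val, ofAdd_toAdd]

/-- The middle coordinates of the elements of trivial top coordinate. -/
def midRange (k : ℕ) : AddSubgroup (Alg k) where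
  carrier := {v | ∃ g p, model k g = ⟨1, v, p⟩}
  add_mem' := by
    rintro u v ⟨g, p, hg⟩ ⟨h, q, hh⟩
    exact ⟨g * h, _, by rw [map_mul, hg, hh, Model.mk_mul]⟩
  zero_mem' := ⟨1, 0, map_one _⟩
  neg_mem' := by
    rintro u ⟨g, p, hg⟩
    exact ⟨g, p, by rwa [CharTwo.neg_eq]⟩

/-- The bottom coordinates of the elements of trivial top and middle coordinates. -/
def botRange (k : ℕ) : AddSubgroup (Alg k) where
  carrier := {p | ∃ g, model k g = ⟨1, 0, p⟩}
  add_mem' := by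
    rintro u v ⟨g, hg⟩ ⟨h, hh⟩
    refine ⟨g * h, ?_⟩
    rw [map_mul, hg, hh, Model.mk_mul]
    simp
  zero_mem' := ⟨1, map_one _⟩
  neg_mem' := by
    rintro u ⟨g, hg⟩
    exact ⟨g, by rwa [CharTwo.neg_eq]⟩

theorem fst_mem_midRange (q : C (2 ^ k)) : fst k q ∈ midRange k := by
  obtain ⟨j, rfl⟩ := exists_gen_pow q
  exact ⟨_, 0, model_conj_y j⟩

/-- The symmetric element of the group algebra that belongs to an unordered pair. -/
def pairElt (k : ℕ) : Sym2 (C (2 ^ k)) → Alg k := Sym2.lift ⟨fun q r => if q = r then fst k q * snd k q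
    else fst k q * snd k r + fst k r * snd k q, by
  intro q r
  by_cases h : q = r
  · simp [h]
  · simp only [if_neg h, if_neg (Ne.symm h), add_comm]⟩

theorem pairElt_mem_botRange (e : Sym2 (C (2 ^ k))) : pairElt k e ∈ botRange k := by
  induction e using Sym2.ind with
  | _ q r =>
    obtain ⟨i, rfl⟩ := exists_gen_pow q
    obtain ⟨j, rfl⟩ := exists_gen_pow r
    rw [pairElt, Sym2.lift_mk]
    simp only
    by_cases h : gen k ^ i = gen k ^ j
    · rw [if_pos h]
      refine ⟨((x k ^ i)⁻¹ * y k * x k ^ i) ^ 2, ?_⟩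
      rw [map_pow, model_conj_y, Model.mk_sq, swap_fst]
    · rw [if_neg h]
      refine ⟨comm ((x k ^ i)⁻¹ * y k * x k ^ i) ((x k ^ j)⁻¹ * y k * x k ^ j), ?_⟩
      rw [map_comm, model_conj_y, model_conj_y, Model.comm_mk_mk, swap_fst, swap_fst]

theorem coeff_pairElt (e : Sym2 (C (2 ^ k))) (q r : C (2 ^ k)) :
    (pairElt k e).coeff (q, r) = if e = s(q, r) then 1 else 0 := by
  induction e using Sym2.ind with
  | _ q' r' =>
    rw [pairElt, Sym2.lift_mk]
    simp only [Sym2.eq_iff]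
    by_cases h : q' = r'
    · subst h
      rw [if_pos rfl, fst_mul_snd, MonoidAlgebra.coeff_single, Finsupp.single_apply]
      refine if_congr ?_ rfl rfl
      rw [Prod.mk.injEq]
      tauto
    · rw [if_neg h, fst_mul_snd, fst_mul_snd, MonoidAlgebra.coeff_add, Finsupp.add_apply,
        MonoidAlgebra.coeff_single, MonoidAlgebra.coeff_single, Finsupp.single_apply,
        Finsupp.single_apply]
      simp only [Prod.mk.injEq]
      by_cases h1 : q' = q ∧ r' = r
      · rw [if_pos h1, if_pos (Or.inl h1), if_neg, add_zero]
        rintro ⟨h2, h3⟩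
        exact h (h1.1.trans h2.symm)
      · rw [if_neg h1, zero_add]
        refine if_congr ?_ rfl rfl
        tauto

/-- The count has one factor for each coordinate: `2^k` powers of `x`, all sums of the conjugates of
`y` in the middle, and all sums of the `pairElt`, indexed by unordered pairs, in the bottom. -/
theorem two_pow_le_card : 2 ^ (k + 2 ^ k + (2 ^ k + 1).choose 2) ≤ Nat.card (G k) := by
  classical
  have hmid : ∀ s : Finset (C (2 ^ k)), ∑ q ∈ s, fst k q ∈ midRange k :=
    fun s => sum_mem fun q _ => fst_mem_midRange q
  have hbot : ∀ s : Finset (Sym2 (C (2 ^ k))), ∑ e ∈ s, pairElt k e ∈ botRange k :=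
    fun s => sum_mem fun e _ => pairElt_mem_botRange e
  choose gm pm hm using hmid
  choose gb hb using hbot
  choose ex hex using exists_gen_pow (k := k)
  let Φ : C (2 ^ k) × Finset (C (2 ^ k)) × Finset (Sym2 (C (2 ^ k))) → G k :=
    fun t => x k ^ ex t.1 * (gm t.2.1 * gb t.2.2)
  have hΦ : ∀ t, model k (Φ t) = ⟨t.1, ∑ q ∈ t.2.1, fst k q, pm t.2.1 + ∑ e ∈ t.2.2, pairElt k e⟩ := by
    intro t
    rw [map_mul, map_mul, map_pow, model_x, Model.x_pow, hm, hb, Model.mk_mul, ← hex]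
    ext1 <;> simp
  have hinj : Function.Injective Φ := by
    rintro ⟨q, s, t⟩ ⟨q', s', t'⟩ h
    have h1 := congrArg (model k) h
    rw [hΦ, hΦ] at h1
    simp only [Model.mk.injEq] at h1
    obtain ⟨h1, h2, h3⟩ := h1
    have hs : s = s' := by
      ext r
      have := congrArg (fun u : Alg k => u.coeff (r, 1)) h2
      simp only [MonoidAlgebra.coeff_sum, Finsupp.finsetSum_apply, fst_eq_single,
        MonoidAlgebra.coeff_single, Finsupp.single_apply, Prod.mk.injEq, and_true,
        Finset.sum_ite_eq'] at this
      by_cases hr : r ∈ s <;> by_cases hr' : r ∈ s' <;> simp [hr, hr'] at this ⊢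
    subst hs
    have h3 := add_left_cancel h3
    have ht : t = t' := by
      ext e
      induction e using Sym2.ind with
      | _ r r' =>
        have := congrArg (fun u : Alg k => u.coeff (r, r')) h3
        simp only [MonoidAlgebra.coeff_sum, Finsupp.finsetSum_apply, coeff_pairElt,
          Finset.sum_ite_eq'] at this
        by_cases hr : s(r, r') ∈ t <;> by_cases hr' : s(r, r') ∈ t' <;> simp [hr, hr'] at this ⊢
    rw [h1, ht]
  have hc := Nat.card_le_card_of_injective Φ hinj
  have h1 : Fintype.card (C (2 ^ k)) = 2 ^ k := by
    rw [Fintype.card_multiplicative, ZMod.card]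
  rw [Nat.card_eq_fintype_card, Fintype.card_prod, Fintype.card_prod, Fintype.card_finset,
    Fintype.card_finset, Sym2.card, h1, ← pow_add, ← pow_add, ← add_assoc] at hc
  exact hc

end Embedding

/-! ### Generators of the lower central series -/

section LowerCentral

open scoped commutatorElement

variable {k : ℕ}

theorem γ_succ {i : ℕ} (hi : 1 ≤ i) : γ k (i + 1) = ⁅γ k i, ⊤⁆ := by
  obtain ⟨j, rfl⟩ : ∃ j, i = j + 1 := ⟨i - 1, by omega⟩
  rfl

theorem γ_one : γ k 1 = ⊤ := rfl

theorem γ_anti {i j : ℕ} (h : i ≤ j) : γ k j ≤ γ k i :=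
  Subgroup.lowerCentralSeries_antitone _ (Nat.sub_le_sub_right h 1)

theorem comm_eq {Γ : Type} [Group Γ] (g h : Γ) : comm g h = ⁅g⁻¹, h⁻¹⁆ := by
  rw [comm, commutatorElement_def, inv_inv, inv_inv]

theorem comm_mem_γ {i : ℕ} (hi : 1 ≤ i) {g : G k} (hg : g ∈ γ k i) (h : G k) :
    comm g h ∈ γ k (i + 1) := by
  rw [γ_succ hi, comm_eq]
  exact Subgroup.commutator_mem_commutator (inv_mem hg) (Subgroup.mem_top _)

theorem iterComm_succ {Γ : Type} [Group Γ] (g h : Γ) (n : ℕ) :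
    iterComm g h (n + 1) = comm (iterComm g h n) h := by
  simp only [iterComm, Function.iterate_succ_apply']

theorem iterComm_mem_γ {i : ℕ} (hi : 1 ≤ i) {g : G k} (hg : g ∈ γ k i) (h : G k) (n : ℕ) :
    iterComm g h n ∈ γ k (i + n) := by
  induction n with
  | zero => exact hg
  | succ n ih =>
    rw [iterComm_succ]
    exact comm_mem_γ (by omega) ih h

theorem c_mem_γ (i : ℕ) : c k (i + 1) ∈ γ k (i + 1) := by
  have h := iterComm_mem_γ le_rfl (show y k ∈ γ k 1 from Subgroup.mem_top _) (x k) i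
  rwa [add_comm] at h

theorem cc_mem_γ (i j : ℕ) : cc k (i + 1) (j + 1) ∈ γ k (i + j + 2) := by
  rw [show i + j + 2 = i + 1 + 1 + j by omega]
  exact iterComm_mem_γ (by omega) (comm_mem_γ (by omega) (c_mem_γ i) _) _ _

theorem map_iterComm {Γ Δ : Type} [Group Γ] [Group Δ] (f : Γ →* Δ) (g h : Γ) (n : ℕ) :
    f (iterComm g h n) = iterComm (f g) (f h) n := by
  induction n with
  | zero => rfl
  | succ n ih => rw [iterComm_succ, iterComm_succ, map_comm, ih]

theorem model_c (i : ℕ) :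
    model k (c k (i + 1)) = ⟨1, Sv k ^ i, tailSeq (Sv k) (Tv k) i⟩ := by
  rw [c, map_iterComm, model_x, model_y, Model.iterComm_y_x]; rfl

theorem model_c_sq (i : ℕ) : model k (c k (i + 1) ^ 2) = ⟨1, 0, Sv k ^ i * Tv k ^ i⟩ := by
  rw [map_pow, model_c, Model.mk_sq, map_pow, swap_Sv]

theorem model_cc (i j : ℕ) : model k (cc k (i + 1) (j + 1)) =
    ⟨1, 0, delta (Sv k) (Tv k) ^ j * symm (Sv k) (Tv k) i 0⟩ := by
  rw [cc, map_iterComm, map_comm, c, map_iterComm, model_x, model_y]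
  simp only [Nat.add_sub_cancel]
  rw [Model.comm_iterComm_y, Model.iterComm_bot_x]

/-- The elements that correspond to alternating elements of degree at least `d`. -/
def altG (k d : ℕ) : Subgroup (G k) where
  carrier := {g | ∃ p ∈ alt (Sv k) (Tv k) d, model k g = ⟨1, 0, p⟩}
  mul_mem' := by
    rintro g h ⟨p, hp, hg⟩ ⟨q, hq, hh⟩
    refine ⟨p + q, add_mem hp hq, ?_⟩
    rw [map_mul, hg, hh, Model.mk_mul]
    simp
  one_mem' := ⟨0, zero_mem _, map_one _⟩
  inv_mem' := by
    rintro g ⟨p, hp, hg⟩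
    refine ⟨p, hp, ?_⟩
    rw [map_inv, hg, Model.mk_inv]
    simp

theorem altG_eq_bot {d : ℕ} (hd : 2 * 2 ^ k ≤ d + 2) : altG k d = ⊥ := by
  rw [eq_bot_iff]
  rintro g ⟨p, hp, hg⟩
  rw [alt_eq_bot Sv_pow Tv_pow hd, AddSubgroup.mem_bot] at hp
  rw [Subgroup.mem_bot]
  refine model_injective ?_
  rw [hg, hp, map_one]; rfl

theorem altG_sq {d : ℕ} {g : G k} (hg : g ∈ altG k d) : g ^ 2 = 1 := by
  obtain ⟨p, -, hg⟩ := hg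
  refine model_injective ?_
  rw [map_pow, hg, Model.mk_sq, map_one, zero_mul]; rfl

theorem comm_x_mem_altG {d : ℕ} {g : G k} (hg : g ∈ altG k d) : comm g (x k) ∈ altG k (d + 1) := by
  obtain ⟨p, hp, hg⟩ := hg
  refine ⟨_, delta_mul_mem_alt hp, ?_⟩
  rw [map_comm, model_x, hg, Model.comm_mk_x]
  simp

theorem comm_y_altG {d : ℕ} {g : G k} (hg : g ∈ altG k d) : comm g (y k) = 1 := by
  obtain ⟨p, hp, hg⟩ := hg
  refine model_injective ?_
  rw [map_comm, model_y, hg, Model.y, Model.comm_mk_mk, map_one]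
  simp
  rfl

theorem comm_c_y_mem_altG (i : ℕ) : comm (c k (i + 1)) (y k) ∈ altG k i := by
  refine ⟨symm (Sv k) (Tv k) i 0, symm_mem_alt (by omega), ?_⟩
  rw [map_comm, model_y, c, map_iterComm, model_x, model_y]
  exact Model.comm_iterComm_y i

/-- The commutators `c_{a+1,j+1}` that correspond to the generators of degree `d` of the alternating
elements. -/
def ccGens (k d : ℕ) : Set (G k) :=
  {g | ∃ a j : ℕ, Odd a ∧ a < 2 ^ k ∧ j + 2 ≤ 2 ^ k ∧ a + j = d ∧ g = cc k (a + 1) (j + 1)}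

theorem ccGens_subset (d : ℕ) : ccGens k d ⊆ altG k d := by
  rintro _ ⟨a, j, -, -, -, hd, rfl⟩
  refine ⟨_, ?_, model_cc a j⟩
  have := delta_pow_mul_mem_alt (symm_mem_alt (S := Sv k) (T := Tv k) (a := a) (b := 0) le_rfl) j
  exact alt_anti (by omega) this

theorem altG_le (d : ℕ) : altG k d ≤ Subgroup.closure (ccGens k d) ⊔ altG k (d + 1) := by
  rintro g ⟨p, hp, hg⟩
  obtain ⟨u, hu, v, hv, rfl⟩ := AddSubgroup.mem_sup.1 (alt_le_altGens Sv_pow Tv_pow d hp)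
  obtain ⟨h, hh, hhu⟩ : ∃ h ∈ Subgroup.closure (ccGens k d), model k h = ⟨1, 0, u⟩ := by
    clear hg hp
    induction hu using AddSubgroup.closure_induction with
    | mem u hu =>
      obtain ⟨a, j, ha, han, hj, hd, rfl⟩ := hu
      exact ⟨_, Subgroup.subset_closure ⟨a, j, ha, han, hj, hd, rfl⟩, model_cc a j⟩
    | zero => exact ⟨1, one_mem _, map_one _⟩
    | add u v _ _ hu hv =>
      obtain ⟨g, hg, hgu⟩ := hu
      obtain ⟨h, hh, hhv⟩ := hv
      refine ⟨g * h, mul_mem hg hh, ?_⟩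
      rw [map_mul, hgu, hhv, Model.mk_mul]
      simp
    | neg u _ hu =>
      obtain ⟨g, hg, hgu⟩ := hu
      exact ⟨g, hg, by rwa [CharTwo.neg_eq]⟩
  have hv : h⁻¹ * g ∈ altG k (d + 1) := by
    refine ⟨v, hv, ?_⟩
    rw [map_mul, map_inv, hg, hhu, Model.mk_inv, Model.mk_mul]
    ext1
    · rfl
    · simp
    · simp only [zero_mul, add_zero]
      rw [← add_assoc, CharTwo.add_self_eq_zero, zero_add]
  rw [← mul_inv_cancel_left h g]
  exact Subgroup.mul_mem_sup hh hv

theorem closure_ccGens_le_γ (d : ℕ) : Subgroup.closure (ccGens k d) ≤ γ k (d + 2) := by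
  refine (Subgroup.closure_le _).2 ?_
  rintro _ ⟨a, j, -, -, -, rfl, rfl⟩
  exact cc_mem_γ a j

/-- Descending induction on `d`: `altG` vanishes in high degree, and each step adds only commutators
`c_{m,n}` of weight `d + 2`. -/
theorem altG_le_γ (d : ℕ) : altG k d ≤ γ k (d + 2) := by
  have key : ∀ t d : ℕ, 2 * 2 ^ k ≤ d + t → altG k d ≤ γ k (d + 2) := by
    intro t
    induction t with
    | zero =>
      intro d hd
      rw [altG_eq_bot (by omega)]
      exact bot_le
    | succ t ih =>
      intro d hd
      refine (altG_le d).trans (sup_le (closure_ccGens_le_γ d) ?_)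
      exact (ih (d + 1) (by omega)).trans (γ_anti (by omega))
  exact key (2 * 2 ^ k) d (by omega)

/-- A subgroup `T` between two consecutive terms is normal. Modulo `T` the generators of `γ k i`
commute with `x` and `y`, hence with everything, so `[γ_i, G]` lies in `T`. -/
theorem γ_succ_le_of_comm_mem {i : ℕ} (hi : 1 ≤ i) {X : Set (G k)} {T : Subgroup (G k)}
    (hX : γ k i ≤ Subgroup.closure X ⊔ γ k (i + 1)) (h1 : γ k (i + 2) ≤ T) (h2 : T ≤ γ k (i + 1))
    (hx : ∀ g ∈ X, comm g (x k) ∈ T) (hy : ∀ g ∈ X, comm g (y k) ∈ T) : γ k (i + 1) ≤ T := by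
  have hn : T.Normal := by
    refine ⟨fun t ht g => ?_⟩
    have h3 : comm t g⁻¹ ∈ T := h1 (comm_mem_γ (by omega) (h2 ht) _)
    have : g * t * g⁻¹ = t * comm t g⁻¹ := by unfold comm; group
    rw [this]
    exact mul_mem ht h3
  let π : G k →* G k ⧸ T := QuotientGroup.mk' T
  have hπ : ∀ g h : G k, comm g h ∈ T ↔ π g * π h = π h * π g := by
    intro g h
    rw [← map_mul, ← map_mul, eq_comm]
    refine Iff.trans ?_ QuotientGroup.eq.symm
    rw [comm]
    simp [mul_assoc]
  have hle : γ k i ≤ (Subgroup.centralizer {π (x k), π (y k)}).comap π := by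
    refine hX.trans (sup_le ((Subgroup.closure_le _).2 ?_) ?_)
    · intro g hg
      change π g ∈ Subgroup.centralizer {π (x k), π (y k)}
      rw [Subgroup.mem_centralizer_iff]
      rintro _ (rfl | rfl)
      · exact ((hπ _ _).1 (hx g hg)).symm
      · exact ((hπ _ _).1 (hy g hg)).symm
    · intro g hg
      change π g ∈ Subgroup.centralizer {π (x k), π (y k)}
      rw [Subgroup.mem_centralizer_iff]
      rintro _ (rfl | rfl) <;> exact ((hπ _ _).1 (h1 (comm_mem_γ (by omega) hg _))).symm
  rw [γ_succ hi, Subgroup.commutator_le]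
  intro g hg h _
  have hg' : π g ∈ Subgroup.centralizer {π (x k), π (y k)} := hle hg
  rw [Subgroup.mem_centralizer_iff] at hg'
  have htop : (⊤ : Subgroup (G k)) ≤ (Subgroup.centralizer {π g}).comap π := by
    rw [← closure_x_y, Subgroup.closure_le]
    rintro _ (rfl | rfl)
    · change π _ ∈ Subgroup.centralizer {π g}
      rw [Subgroup.mem_centralizer_singleton_iff]
      exact hg' _ (by simp)
    · change π _ ∈ Subgroup.centralizer {π g}
      rw [Subgroup.mem_centralizer_singleton_iff]
      exact hg' _ (by simp)
  have hh : π h ∈ Subgroup.centralizer {π g} := htop (Subgroup.mem_top h)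
  rw [Subgroup.mem_centralizer_singleton_iff] at hh
  have : π ⁅g, h⁆ = 1 := by
    rw [map_commutatorElement, commutatorElement_eq_one_iff_mul_comm, hh]
  exact (QuotientGroup.eq_one_iff _).1 this

/-- The generators reproduce themselves: `[c_i, x] = c_{i+1}`, `[c_i, y]` is alternating, `x` raises
the degree of alternating elements, and `y` centralizes them. -/
theorem γ_le_c_sup_altG (i : ℕ) :
    γ k (i + 2) ≤ Subgroup.closure ({c k (i + 2)} ∪ altG k i) ⊔ γ k (i + 3) := by
  have hle : ∀ i, Subgroup.closure ({c k (i + 2)} ∪ altG k i) ⊔ γ k (i + 3) ≤ γ k (i + 2) := by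
    intro i
    refine sup_le ((Subgroup.closure_le _).2 (Set.union_subset ?_ (altG_le_γ i))) (γ_anti (by omega))
    rw [Set.singleton_subset_iff]
    exact c_mem_γ (i + 1)
  have hc : ∀ i, c k (i + 2) ∈ Subgroup.closure ({c k (i + 2)} ∪ altG k i) ⊔ γ k (i + 3) :=
    fun i => Subgroup.mem_sup_left (Subgroup.subset_closure (Or.inl rfl))
  have hcs : ∀ i, comm (c k (i + 1)) (x k) = c k (i + 2) := fun i =>
    (iterComm_succ (y k) (x k) i).symm
  induction i with
  | zero =>
    refine γ_succ_le_of_comm_mem le_rfl (X := {x k, y k}) ?_ le_sup_right (hle 0) ?_ ?_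
    · rw [closure_x_y]
      exact le_sup_of_le_left le_top
    · rintro g (rfl | rfl)
      · simp [comm]
      · exact hc 0
    · rintro g (rfl | rfl)
      · have : comm (x k) (y k) = (comm (y k) (x k))⁻¹ := by unfold comm; group
        rw [this]
        exact inv_mem (hc 0)
      · simp [comm]
  | succ i ih =>
    refine γ_succ_le_of_comm_mem (by omega) ih le_sup_right (hle (i + 1)) ?_ ?_
    · rintro g (rfl | hg)
      · rw [hcs (i + 1)]
        exact hc (i + 1)
      · exact Subgroup.mem_sup_left (Subgroup.subset_closure (Or.inr (comm_x_mem_altG hg)))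
    · rintro g (rfl | hg)
      · exact Subgroup.mem_sup_left (Subgroup.subset_closure (Or.inr (comm_c_y_mem_altG (i + 1))))
      · rw [comm_y_altG hg]
        exact one_mem _

theorem γ_eq_c_sup_ccGens (i : ℕ) :
    γ k (i + 2) = Subgroup.closure ({c k (i + 2)} ∪ ccGens k i) ⊔ γ k (i + 3) := by
  refine le_antisymm ((γ_le_c_sup_altG i).trans (sup_le ?_ le_sup_right))
    (sup_le ((Subgroup.closure_le _).2 (Set.union_subset ?_ ?_)) (γ_anti (by omega)))
  · refine (Subgroup.closure_le _).2 (Set.union_subset ?_ ?_)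
    · rw [Set.singleton_subset_iff]
      exact Subgroup.mem_sup_left (Subgroup.subset_closure (Or.inl rfl))
    · refine (altG_le i).trans (sup_le ?_ ?_)
      · exact (Subgroup.closure_mono Set.subset_union_right).trans le_sup_left
      · exact (altG_le_γ (i + 1)).trans le_sup_right
  · rw [Set.singleton_subset_iff]
    exact c_mem_γ (i + 1)
  · exact Subgroup.subset_closure.trans (closure_ccGens_le_γ i)

/-- For such `r` the exceptional monomial of `tailSeq_two_pow_add` has exponents at least `2^k` and
vanishes. -/
theorem c_mem_altG (hk : 1 ≤ k) {r : ℕ} (hr : 2 ^ (k - 1) ≤ r) :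
    c k (2 ^ k + r + 1) ∈ altG k (2 ^ k + r) := by
  have h2 : 2 ^ k = 2 ^ (k - 1) + 2 ^ (k - 1) := by
    rw [← two_mul, ← pow_succ', Nat.sub_add_cancel hk]
  refine ⟨tailSeq (Sv k) (Tv k) (2 ^ k + r), ?_, ?_⟩
  · have := tailSeq_two_pow_add hk Sv_pow Tv_pow r (S := Sv k) (T := Tv k)
    rwa [pow_eq_zero_of_le (show 2 ^ k ≤ 2 ^ (k - 1) + r by omega) Sv_pow, zero_mul,
      sub_zero] at this
  · rw [model_c, pow_add, Sv_pow, zero_mul]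

theorem c_mem_γ_succ (hk : 1 ≤ k) {i : ℕ} (hi : 2 ^ k + 2 ^ (k - 1) < i) :
    c k i ∈ γ k (i + 1) := by
  have h : 0 < 2 ^ (k - 1) := by positivity
  obtain ⟨r, rfl⟩ : ∃ r, i = 2 ^ k + r + 1 := ⟨i - 2 ^ k - 1, by omega⟩
  exact altG_le_γ _ (c_mem_altG hk (by omega))

/-- The square is the exceptional monomial in `tailSeq_two_pow_add`, so it differs from
`c_{2^k+r+1}` only by an alternating element. -/
theorem c_sq_mem_γ (hk : 1 ≤ k) (r : ℕ) :
    c k (2 ^ (k - 1) + r + 1) ^ 2 ∈ γ k (2 ^ k + r + 1) := by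
  have h : (c k (2 ^ k + r + 1))⁻¹ * c k (2 ^ (k - 1) + r + 1) ^ 2 ∈ altG k (2 ^ k + r) := by
    refine ⟨_, tailSeq_two_pow_add hk Sv_pow Tv_pow r, ?_⟩
    rw [map_mul, map_inv, model_c_sq, model_c, pow_add, Sv_pow, zero_mul, Model.mk_inv,
      Model.mk_mul]
    ext1
    · rfl
    · simp
    · simp [CharTwo.sub_eq_add]
  rw [← mul_inv_cancel_left (c k (2 ^ k + r + 1)) (c k (2 ^ (k - 1) + r + 1) ^ 2)]
  exact mul_mem (c_mem_γ _) (γ_anti (by omega) (altG_le_γ _ h))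

theorem c_sq_mem_γ_succ (hk : 1 ≤ k) {i : ℕ} (hi : 2 ^ (k - 1) < i) :
    c k i ^ 2 ∈ γ k (i + 1) := by
  have h2 : 2 ^ k = 2 ^ (k - 1) + 2 ^ (k - 1) := by
    rw [← two_mul, ← pow_succ', Nat.sub_add_cancel hk]
  have h3 : 0 < 2 ^ (k - 1) := by positivity
  obtain ⟨r, rfl⟩ : ∃ r, i = 2 ^ (k - 1) + r + 1 := ⟨i - 2 ^ (k - 1) - 1, by omega⟩
  exact γ_anti (by omega) (c_sq_mem_γ hk r)

theorem c_pow_four (i : ℕ) : c k (i + 1) ^ 4 = 1 := by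
  refine model_injective ?_
  rw [show 4 = 2 * 2 by rfl, pow_mul, map_pow, model_c_sq, Model.mk_sq, map_one, zero_mul]
  rfl

theorem isNilpotent_G : Group.IsNilpotent (G k) := by
  have : Fact (Nat.Prime 2) := ⟨Nat.prime_two⟩
  exact (isPGroup_G k).isNilpotent

/-- At this index there are no alternating elements left and `c_i` lies one step deeper, so the
series is stationary; in a nilpotent group it must then be trivial. -/
theorem γ_two_pow_succ (hk : 1 ≤ k) : γ k (2 ^ (k + 1)) = ⊥ := by
  have h2 : 2 ^ k = 2 ^ (k - 1) + 2 ^ (k - 1) := by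
    rw [← two_mul, ← pow_succ', Nat.sub_add_cancel hk]
  have h3 : 0 < 2 ^ (k - 1) := by positivity
  have h4 : 2 ^ (k + 1) = 2 * 2 ^ k := by ring
  obtain ⟨i, hi⟩ : ∃ i, 2 ^ (k + 1) = i + 2 := ⟨2 ^ (k + 1) - 2, by omega⟩
  rw [hi]
  have h5 : γ k (i + 2) ≤ γ k (i + 3) := by
    refine (γ_le_c_sup_altG i).trans (sup_le ((Subgroup.closure_le _).2 ?_) le_rfl)
    rw [altG_eq_bot (by omega)]
    refine Set.union_subset ?_ ?_
    · rw [Set.singleton_subset_iff]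
      exact c_mem_γ_succ hk (by omega)
    · intro g hg
      rw [SetLike.mem_coe, Subgroup.mem_bot] at hg
      rw [hg]
      exact one_mem _
  have h6 : ∀ j, γ k (i + 2) ≤ γ k (i + 2 + j) := by
    intro j
    induction j with
    | zero => exact le_rfl
    | succ j ih =>
      rw [← add_assoc, γ_succ (i := i + 2 + j) (by omega)]
      refine h5.trans ?_
      rw [show i + 3 = i + 2 + 1 by rfl, γ_succ (i := i + 2) (by omega)]
      exact Subgroup.commutator_mono ih le_rfl
  obtain ⟨m, hm⟩ := Subgroup.nilpotent_iff_lowerCentralSeries.1 (isNilpotent_G (k := k))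
  rw [eq_bot_iff]
  refine (h6 m).trans ((γ_anti (show m + 1 ≤ i + 2 + m by omega)).trans ?_)
  exact hm.le

end LowerCentral

section Factors

open scoped commutatorElement

/-! ### Abelian groups with given generators -/

theorem exists_surjective_pi {Q : Type*} [CommGroup Q] {r : ℕ} (w : Fin r → Q)
    (hw : ∀ j, w j ^ 2 = 1) : ∃ f : (Fin r → C 2) →* Q, Subgroup.closure (Set.range w) ≤ f.range := by
  let f : (Fin r → C 2) →* Q :=
    ∏ j, (cyc (w j) (hw j)).comp (Pi.evalMonoidHom (fun _ : Fin r => C 2) j)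
  refine ⟨f, (Subgroup.closure_le _).2 ?_⟩
  rintro _ ⟨j, rfl⟩
  refine ⟨Pi.mulSingle j (Multiplicative.ofAdd 1), ?_⟩
  simp only [f, MonoidHom.finsetProd_apply, MonoidHom.comp_apply, Pi.evalMonoidHom_apply]
  rw [Finset.prod_eq_single j, Pi.mulSingle_eq_same, cyc_ofAdd_one]
  · intro i _ hij
    rw [Pi.mulSingle_eq_of_ne hij, map_one]
  · simp

/-- The hypothesis `h` says that `u` and the image of `f` together generate `Q`. -/
theorem exists_surjective_prod {Q : Type*} [CommGroup Q] {m : ℕ} (u : Q) (hu : u ^ m = 1)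
    {P : Type*} [CommGroup P] (f : P →* Q) (h : ∀ T : Subgroup Q, u ∈ T → f.range ≤ T → T = ⊤) :
    ∃ g : C m × P →* Q, Function.Surjective g := by
  refine ⟨(cyc u hu).coprod f, ?_⟩
  rw [← MonoidHom.range_eq_top]
  refine h _ ⟨(Multiplicative.ofAdd 1, 1), ?_⟩ ?_
  · rw [MonoidHom.coprod_apply]
    exact (congrArg₂ _ (cyc_ofAdd_one u hu) (map_one f)).trans (mul_one u)
  · rintro _ ⟨p, rfl⟩
    exact ⟨(1, p), by simp⟩

variable {k : ℕ}

instance (k i : ℕ) : IsMulCommutative (factor k i) := by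
  refine ⟨⟨fun u v => ?_⟩⟩
  obtain ⟨⟨g, hg⟩, rfl⟩ := QuotientGroup.mk_surjective u
  obtain ⟨⟨h, hh⟩, rfl⟩ := QuotientGroup.mk_surjective v
  refine QuotientGroup.eq.2 (Subgroup.mem_subgroupOf.2 ?_)
  -- By truncated subtraction `γ k 0` and `γ k 1` are both the whole group, so the factor with index
  -- `0` is trivial.
  rcases Nat.eq_zero_or_pos i with rfl | hi
  · exact Subgroup.mem_top _
  · have h3 := comm_mem_γ hi (inv_mem hg) h⁻¹
    have h4 := (inferInstance : (γ k (i + 1)).Normal).conj_mem _ h3 (h⁻¹ * g⁻¹)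
    have h5 := comm_mem_γ hi hh g
    convert h5 using 1
    simp only [comm, Subgroup.coe_mul, Subgroup.coe_inv, mul_inv_rev]
    group

/-- The abelian group structure of a factor of the lower central series. -/
instance (k i : ℕ) : CommGroup (factor k i) :=
  { (inferInstance : Group (factor k i)) with
    mul_comm := (inferInstance : IsMulCommutative (factor k i)).is_comm.comm }

theorem eq_top_of_mk_mem {i : ℕ} {X : Set (G k)} (hX : γ k i ≤ Subgroup.closure X ⊔ γ k (i + 1))
    (hXi : X ⊆ γ k i) {T : Subgroup (factor k i)}
    (h : ∀ g (hg : g ∈ X), (QuotientGroup.mk ⟨g, hXi hg⟩ : factor k i) ∈ T) : T = ⊤ := by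
  rw [eq_top_iff]
  rintro u -
  obtain ⟨⟨g, hg⟩, rfl⟩ := QuotientGroup.mk_surjective u
  have hle : γ k i ≤ (T.comap (QuotientGroup.mk' _)).map (γ k i).subtype := by
    refine hX.trans (sup_le ((Subgroup.closure_le _).2 fun g hg => ?_) fun g hg => ?_)
    · exact ⟨⟨g, hXi hg⟩, h g hg, rfl⟩
    · refine ⟨⟨g, γ_anti (Nat.le_succ i) hg⟩, ?_, rfl⟩
      have : (QuotientGroup.mk ⟨g, γ_anti (Nat.le_succ i) hg⟩ : factor k i) = 1 :=
        (QuotientGroup.eq_one_iff _).2 (Subgroup.mem_subgroupOf.2 hg)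
      change QuotientGroup.mk _ ∈ T
      rw [this]
      exact one_mem T
  obtain ⟨g', hg', hgg⟩ := hle hg
  have : g' = ⟨g, hg⟩ := Subtype.ext hgg
  rw [← this]
  exact hg'

theorem mk_pow_eq_one {i m : ℕ} {g : G k} (hg : g ∈ γ k i) (h : g ^ m ∈ γ k (i + 1)) :
    (QuotientGroup.mk ⟨g, hg⟩ : factor k i) ^ m = 1 :=
  let u : γ k i := ⟨g, hg⟩
  (QuotientGroup.eq_one_iff (u ^ m)).2 (Subgroup.mem_subgroupOf.2 h)

/-! ### The generators of the factors -/

/-- The number of the generators `c_{m,n}` of the `i`-th factor. -/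
def rk (k i : ℕ) : ℕ := if i ≤ 2 ^ k then (i - 1) / 2 else (2 * 2 ^ k - i + 1) / 2

theorem two_pow_eq (hk : 1 ≤ k) : 2 ^ k = 2 * 2 ^ (k - 1) := by
  rw [← pow_succ', Nat.sub_add_cancel hk]

theorem exists_range_eq_ccGens (hk : 1 ≤ k) {i : ℕ} (hi : 2 ≤ i) (hi2 : i ≤ 2 * 2 ^ k) :
    ∃ w : Fin (rk k i) → G k, Set.range w = ccGens k (i - 2) := by
  have h2 := two_pow_eq hk
  have h3 : 0 < 2 ^ (k - 1) := by positivity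
  obtain ⟨r, hr⟩ : ∃ r, r = rk k i := ⟨_, rfl⟩
  rw [← hr]
  rw [rk] at hr
  split_ifs at hr with h
  -- Up to `2^k` the even index `m` is counted upwards from `2`.
  · refine ⟨fun t => cc k (2 * t + 2) (i - 2 * t - 2), Set.ext fun g => ⟨?_, ?_⟩⟩
    · rintro ⟨⟨t, ht⟩, rfl⟩
      refine ⟨2 * t + 1, i - 2 * t - 3, ⟨t, rfl⟩, by omega, by omega, by omega, ?_⟩
      simp only
      congr 1; omega
    · rintro ⟨a, j, ⟨t, ht⟩, ha, hj, hd, rfl⟩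
      refine ⟨⟨t, by omega⟩, ?_⟩
      simp only
      congr 1 <;> omega
  -- Beyond `2^k` it is counted downwards from its largest value `2^k`.
  · refine ⟨fun t => cc k (2 ^ k - 2 * t) (i - (2 ^ k - 2 * t)), Set.ext fun g => ⟨?_, ?_⟩⟩
    · rintro ⟨⟨t, ht⟩, rfl⟩
      refine ⟨2 ^ k - 2 * t - 1, i - 1 - 2 ^ k + 2 * t, ⟨2 ^ (k - 1) - t - 1, by omega⟩, by omega,
        by omega, by omega, ?_⟩
      simp only
      congr 1 <;> omega
    · rintro ⟨a, j, ⟨t, ht⟩, ha, hj, hd, rfl⟩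
      refine ⟨⟨2 ^ (k - 1) - 1 - t, by omega⟩, ?_⟩
      simp only
      congr 1 <;> omega

theorem γ_eq {i : ℕ} (hi : 2 ≤ i) :
    γ k i = Subgroup.closure ({c k i} ∪ ccGens k (i - 2)) ⊔ γ k (i + 1) := by
  obtain ⟨j, rfl⟩ : ∃ j, i = j + 2 := ⟨i - 2, by omega⟩
  exact γ_eq_c_sup_ccGens j

theorem γ_eq_of_c_mem {i : ℕ} (hi : 2 ≤ i) (hc : c k i ∈ γ k (i + 1)) :
    γ k i = Subgroup.closure (ccGens k (i - 2)) ⊔ γ k (i + 1) := by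
  rw [γ_eq hi]
  refine le_antisymm (sup_le ((Subgroup.closure_le _).2 (Set.union_subset ?_ ?_)) le_sup_right)
    (sup_le_sup_right (Subgroup.closure_mono Set.subset_union_right) _)
  · rw [Set.singleton_subset_iff]
    exact Subgroup.mem_sup_right hc
  · exact Subgroup.subset_closure.trans
      (SetLike.coe_subset_coe.2 (le_sup_left : _ ≤ Subgroup.closure (ccGens k (i - 2)) ⊔ γ k (i + 1)))

theorem ccGens_subset_γ {i : ℕ} (hi : 2 ≤ i) : ccGens k (i - 2) ⊆ γ k i := by
  obtain ⟨j, rfl⟩ : ∃ j, i = j + 2 := ⟨i - 2, by omega⟩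
  exact Subgroup.subset_closure.trans (closure_ccGens_le_γ j)

theorem c_mem {i : ℕ} (hi : 2 ≤ i) : c k i ∈ γ k i := by
  obtain ⟨j, rfl⟩ : ∃ j, i = j + 1 := ⟨i - 1, by omega⟩
  exact c_mem_γ j

/-- Homomorphisms to a factor whose image contains the generators `c_{m,n}`. -/
theorem exists_hom_factor (hk : 1 ≤ k) {i : ℕ} (hi : 2 ≤ i) (hi2 : i ≤ 2 * 2 ^ k) :
    ∃ f : (Fin (rk k i) → C 2) →* factor k i, ∀ g (hg : g ∈ ccGens k (i - 2)),
      (QuotientGroup.mk ⟨g, ccGens_subset_γ hi hg⟩ : factor k i) ∈ f.range := by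
  obtain ⟨w, hw⟩ := exists_range_eq_ccGens hk hi hi2
  have hwm : ∀ j, w j ∈ ccGens k (i - 2) := fun j => hw ▸ ⟨j, rfl⟩
  obtain ⟨f, hf⟩ := exists_surjective_pi
    (fun j => (QuotientGroup.mk ⟨w j, ccGens_subset_γ hi (hwm j)⟩ : factor k i)) (fun j =>
      mk_pow_eq_one _ (by rw [altG_sq (ccGens_subset _ (hwm j))]; exact one_mem _))
  refine ⟨f, fun g hg => hf (Subgroup.subset_closure ?_)⟩
  obtain ⟨j, rfl⟩ := hw.symm ▸ hg
  exact ⟨j, rfl⟩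

theorem exists_surjective_factor_one : ∃ f : C (2 ^ k) × C 4 →* factor k 1, Function.Surjective f := by
  have hx : x k ∈ γ k 1 := Subgroup.mem_top _
  have hy : y k ∈ γ k 1 := Subgroup.mem_top _
  have hX : ({x k, y k} : Set (G k)) ⊆ γ k 1 := fun _ _ => Subgroup.mem_top _
  have hy4 : (QuotientGroup.mk ⟨y k, hy⟩ : factor k 1) ^ 4 = 1 :=
    mk_pow_eq_one _ (by rw [show y k = c k (0 + 1) from rfl, c_pow_four]; exact one_mem _)
  refine exists_surjective_prod (QuotientGroup.mk ⟨x k, hx⟩)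
    (mk_pow_eq_one _ (by rw [x_pow_two_pow]; exact one_mem _)) (cyc _ hy4) fun T h1 h2 => ?_
  refine eq_top_of_mk_mem (by rw [closure_x_y]; exact le_sup_of_le_left le_top) hX ?_
  rintro g (rfl | rfl)
  · exact h1
  · exact h2 ⟨Multiplicative.ofAdd 1, cyc_ofAdd_one _ _⟩

theorem union_subset_γ {i : ℕ} (hi : 2 ≤ i) : {c k i} ∪ ccGens k (i - 2) ⊆ (γ k i : Set (G k)) :=
  Set.union_subset (Set.singleton_subset_iff.2 (c_mem hi)) (ccGens_subset_γ hi)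

theorem exists_surjective_factor_of_pow (hk : 1 ≤ k) {i m : ℕ} (hi : 2 ≤ i) (hi2 : i ≤ 2 * 2 ^ k)
    (hm : c k i ^ m ∈ γ k (i + 1)) :
    ∃ f : C m × (Fin (rk k i) → C 2) →* factor k i, Function.Surjective f := by
  obtain ⟨f, hf⟩ := exists_hom_factor hk hi hi2
  refine exists_surjective_prod _ (mk_pow_eq_one (c_mem hi) hm) f fun T h1 h2 => ?_
  refine eq_top_of_mk_mem (γ_eq hi).le (union_subset_γ hi) ?_
  rintro g (rfl | hg)
  · exact h1
  · exact h2 (hf g hg)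

theorem exists_surjective_factor_of_mem (hk : 1 ≤ k) {i : ℕ} (hi : 2 ≤ i) (hi2 : i ≤ 2 * 2 ^ k)
    (hm : c k i ∈ γ k (i + 1)) :
    ∃ f : (Fin (rk k i) → C 2) →* factor k i, Function.Surjective f := by
  obtain ⟨f, hf⟩ := exists_hom_factor hk hi hi2
  refine ⟨f, ?_⟩
  rw [← MonoidHom.range_eq_top]
  exact eq_top_of_mk_mem (γ_eq_of_c_mem hi hm).le (ccGens_subset_γ hi) hf

/-! ### The orders of the factors -/

/-- The binary logarithm of the order of the `i`-th factor. -/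
def expo (k i : ℕ) : ℕ := (if i = 1 then k else 0) + (if i ≤ 2 ^ k + 2 ^ (k - 1) then 1 else 0) +
  (if i ≤ 2 ^ (k - 1) then 1 else 0) + rk k i

theorem card_C (m : ℕ) : Nat.card (C m) = m := Nat.card_zmod m

theorem card_pi_C (r : ℕ) : Nat.card (Fin r → C 2) = 2 ^ r := by
  rw [Nat.card_fun, card_C, Nat.card_eq_fintype_card, Fintype.card_fin]

theorem card_factor_le (hk : 1 ≤ k) {i : ℕ} (hi : 1 ≤ i) (hi2 : i ≤ 2 * 2 ^ k) :
    Nat.card (factor k i) ≤ 2 ^ expo k i := by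
  have h2 := two_pow_eq hk
  have h3 : 0 < 2 ^ (k - 1) := by positivity
  rcases hi.eq_or_lt with rfl | hi
  · obtain ⟨f, hf⟩ := exists_surjective_factor_one (k := k)
    refine (Nat.card_le_card_of_surjective f hf).trans ?_
    rw [Nat.card_prod, card_C, card_C, expo, rk, if_pos rfl, if_pos (by omega), if_pos (show 1 ≤ 2 ^ (k - 1) from h3),
      if_pos (by omega)]
    simp only [pow_add]
    norm_num [mul_assoc]
  · have hi : 2 ≤ i := hi
    rw [expo, if_neg (by omega)]
    split_ifs with h4 h5
    · obtain ⟨f, hf⟩ := exists_surjective_factor_of_pow hk hi hi2 (m := 4) (by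
        obtain ⟨j, rfl⟩ : ∃ j, i = j + 1 := ⟨i - 1, by omega⟩
        rw [c_pow_four]
        exact one_mem _)
      refine (Nat.card_le_card_of_surjective f hf).trans ?_
      rw [Nat.card_prod, card_C, card_pi_C, pow_add]
      norm_num
    · obtain ⟨f, hf⟩ := exists_surjective_factor_of_pow hk hi hi2 (m := 2)
        (c_sq_mem_γ_succ hk (by omega))
      refine (Nat.card_le_card_of_surjective f hf).trans ?_
      rw [Nat.card_prod, card_C, card_pi_C, pow_add]
      norm_num
    · omega
    · obtain ⟨f, hf⟩ := exists_surjective_factor_of_mem hk hi hi2 (c_mem_γ_succ hk (by omega))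
      refine (Nat.card_le_card_of_surjective f hf).trans ?_
      rw [card_pi_C, pow_add]
      simp

theorem card_γ (i : ℕ) : Nat.card (γ k i) = Nat.card (factor k i) * Nat.card (γ k (i + 1)) := by
  rw [Subgroup.card_eq_card_quotient_mul_card_subgroup ((γ k (i + 1)).subgroupOf (γ k i)),
    Nat.card_congr (Subgroup.subgroupOfEquivOfLe (γ_anti (Nat.le_succ i))).toEquiv]

theorem card_G_eq_prod (m : ℕ) : Nat.card (G k) =
    (∏ i ∈ Finset.range m, Nat.card (factor k (i + 1))) * Nat.card (γ k (m + 1)) := by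
  induction m with
  | zero =>
    rw [Finset.prod_range_zero, one_mul, zero_add, γ_one]
    exact (Nat.card_congr Subgroup.topEquiv.toEquiv).symm
  | succ m ih => rw [ih, Finset.prod_range_succ, card_γ (m + 1), mul_assoc]

theorem sum_range_ite_lt {m N : ℕ} (h : m ≤ N) :
    ∑ i ∈ Finset.range N, (if i < m then 1 else 0) = m := by
  rw [← Finset.sum_filter, Finset.sum_const, smul_eq_mul, mul_one]
  have : (Finset.range N).filter (· < m) = Finset.range m := by
    ext i
    simp only [Finset.mem_filter, Finset.mem_range]
    omega
  rw [this, Finset.card_range]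

theorem sum_range_half (h : ℕ) : ∑ i ∈ Finset.range (2 * h), i / 2 + h = h * h := by
  induction h with
  | zero => simp
  | succ h ih =>
    rw [show 2 * (h + 1) = 2 * h + 1 + 1 by ring, Finset.sum_range_succ, Finset.sum_range_succ,
      show 2 * h / 2 = h by omega, show (2 * h + 1) / 2 = h by omega]
    linarith

/-- The ranks are `0, 0, 1, 1, …, h-1, h-1` up to index `2^k = 2h`, and then `h, h-1, h-1, …, 1, 1`.
-/
theorem sum_rk (hk : 1 ≤ k) : ∑ i ∈ Finset.range (2 * 2 ^ k - 1), rk k (i + 1) + 2 ^ (k - 1) =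
    2 * 2 ^ (k - 1) * 2 ^ (k - 1) := by
  set h := 2 ^ (k - 1) with hh
  have h2 : 2 ^ k = 2 * h := two_pow_eq hk
  have h3 : 0 < h := by positivity
  have e1 : ∀ i ∈ Finset.range (2 * h), rk k (i + 1) = i / 2 := by
    intro i hi
    rw [Finset.mem_range] at hi
    rw [rk, if_pos (by omega), Nat.add_sub_cancel]
  have e2 : ∀ i ∈ Finset.range (2 * h - 1), rk k (2 * h + i + 1) = (2 * h - 1 - 1 - i + 2) / 2 := by
    intro i hi
    rw [Finset.mem_range] at hi
    rw [rk, if_neg (by omega), h2]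
    congr 1
    omega
  have e3 := Finset.sum_range_reflect (fun i => (i + 2) / 2) (2 * h - 1)
  have e4 : ∑ i ∈ Finset.range (2 * h + 1), i / 2 =
      ∑ i ∈ Finset.range (2 * h - 1), (i + 2) / 2 := by
    rw [show 2 * h + 1 = 2 * h - 1 + 1 + 1 by omega, Finset.sum_range_succ', Finset.sum_range_succ']
    simp [add_assoc]
  have e5 := sum_range_half h
  rw [show 2 * 2 ^ k - 1 = 2 * h + (2 * h - 1) by omega, Finset.sum_range_add,
    Finset.sum_congr rfl e1, Finset.sum_congr rfl e2, e3, ← e4, Finset.sum_range_succ,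
    show 2 * h / 2 = h by omega]
  linarith

theorem sum_expo (hk : 1 ≤ k) : ∑ i ∈ Finset.range (2 * 2 ^ k - 1), expo k (i + 1) =
    k + 2 ^ k + (2 ^ k + 1).choose 2 := by
  have hr := sum_rk hk
  set h := 2 ^ (k - 1) with hh
  have h2 : 2 ^ k = 2 * h := two_pow_eq hk
  have h3 : 0 < h := by positivity
  have e : ∀ i ∈ Finset.range (2 * 2 ^ k - 1), expo k (i + 1) = (if i = 0 then k else 0) +
      (if i < 3 * h then 1 else 0) + (if i < h then 1 else 0) + rk k (i + 1) := by
    intro i _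
    rw [expo]
    refine congrArg₂ _ (congrArg₂ _ (congrArg₂ _ ?_ ?_) ?_) rfl
    · exact if_congr (by omega) rfl rfl
    · exact if_congr (by omega) rfl rfl
    · exact if_congr (by omega) rfl rfl
  have hch : (2 * h + 1).choose 2 = (2 * h + 1) * h := by
    rw [Nat.choose_two_right, Nat.add_sub_cancel, show (2 * h + 1) * (2 * h) = (2 * h + 1) * h * 2 by
      ring, Nat.mul_div_cancel _ two_pos]
  rw [Finset.sum_congr rfl e, Finset.sum_add_distrib, Finset.sum_add_distrib,
    Finset.sum_add_distrib, sum_range_ite_lt (by omega), sum_range_ite_lt (by omega),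
    Finset.sum_ite_eq' _ 0, if_pos (Finset.mem_range.2 (by omega)), h2, hch]
  rw [h2] at hr
  linarith

/-- If one upper bound were strict, the product of the orders of the factors would fall below the
lower bound for the order of `G k`. -/
theorem card_factor (hk : 1 ≤ k) {i : ℕ} (hi : 1 ≤ i) (hi2 : i ≤ 2 * 2 ^ k) :
    Nat.card (factor k i) = 2 ^ expo k i := by
  have h2 := two_pow_eq hk
  have h3 : 0 < 2 ^ (k - 1) := by positivity
  have hbot : γ k (2 * 2 ^ k) = ⊥ := by
    rw [← pow_succ']
    exact γ_two_pow_succ hk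
  rcases hi2.eq_or_lt with rfl | hi2
  · have h4 := card_γ (k := k) (2 * 2 ^ k)
    have h5 : γ k (2 * 2 ^ k + 1) = ⊥ := by
      rw [eq_bot_iff, ← hbot]
      exact γ_anti (Nat.le_succ _)
    rw [h5, hbot, Subgroup.card_bot, mul_one] at h4
    rw [← h4, expo, rk, if_neg (by omega), if_neg (by omega), if_neg (by omega), if_neg (by omega),
      Nat.sub_self]
    rfl
  · have hcard := card_G_eq_prod (k := k) (2 * 2 ^ k - 1)
    rw [show 2 * 2 ^ k - 1 + 1 = 2 * 2 ^ k by omega, hbot, Subgroup.card_bot, mul_one] at hcard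
    have hlow := two_pow_le_card (k := k)
    rw [hcard, ← sum_expo hk, ← Finset.prod_pow_eq_pow_sum] at hlow
    have hle : ∀ j ∈ Finset.range (2 * 2 ^ k - 1),
        Nat.card (factor k (j + 1)) ≤ 2 ^ expo k (j + 1) := fun j hj => by
      rw [Finset.mem_range] at hj
      exact card_factor_le hk (by omega) (by omega)
    by_contra hne
    refine absurd hlow (not_le.2 (Finset.prod_lt_prod (fun j _ => Nat.card_pos) hle
      ⟨i - 1, Finset.mem_range.2 (by omega), ?_⟩))
    rw [Nat.sub_add_cancel hi]
    exact lt_of_le_of_ne (card_factor_le hk hi hi2.le) hne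

theorem nonempty_mulEquiv_of_surjective {P Q : Type*} [Group P] [Group Q] [Finite P] {f : P →* Q}
    (hf : Function.Surjective f) (h : Nat.card P = Nat.card Q) : Nonempty (Q ≃* P) := by
  have := Finite.of_surjective f hf
  exact ⟨(MulEquiv.ofBijective f ((Nat.bijective_iff_surjective_and_card f).2 ⟨hf, h⟩)).symm⟩

theorem factor_one_equiv (hk : 1 ≤ k) : Nonempty (factor k 1 ≃* C (2 ^ k) × C 4) := by
  have h2 := two_pow_eq hk
  have h3 : 0 < 2 ^ (k - 1) := by positivity
  obtain ⟨f, hf⟩ := exists_surjective_factor_one (k := k)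
  refine nonempty_mulEquiv_of_surjective hf ?_
  rw [card_factor hk le_rfl (by omega), Nat.card_prod, card_C, card_C, expo, rk, if_pos rfl,
    if_pos (by omega), if_pos (show 1 ≤ 2 ^ (k - 1) from h3), if_pos (by omega)]
  simp only [pow_add]
  norm_num [mul_assoc]

theorem factor_equiv_four (hk : 1 ≤ k) {i r : ℕ} (hi : 2 ≤ i) (hi2 : i ≤ 2 ^ (k - 1))
    (hr : r = rk k i) : Nonempty (factor k i ≃* C 4 × (Fin r → C 2)) := by
  subst hr
  have h2 := two_pow_eq hk
  obtain ⟨f, hf⟩ := exists_surjective_factor_of_pow hk hi (by omega) (m := 4) (by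
    obtain ⟨j, rfl⟩ : ∃ j, i = j + 1 := ⟨i - 1, by omega⟩
    rw [c_pow_four]
    exact one_mem _)
  refine nonempty_mulEquiv_of_surjective hf ?_
  rw [card_factor hk (by omega) (by omega), Nat.card_prod, card_C, card_pi_C, expo,
    if_neg (by omega), if_pos (by omega), if_pos (by omega), pow_add]
  norm_num

theorem factor_equiv_two (hk : 1 ≤ k) {i r : ℕ} (hi : 2 ≤ i) (hi1 : 2 ^ (k - 1) < i)
    (hi2 : i ≤ 2 ^ k + 2 ^ (k - 1)) (hr : r = rk k i + 1) :
    Nonempty (factor k i ≃* (Fin r → C 2)) := by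
  subst hr
  have h2 := two_pow_eq hk
  obtain ⟨f, hf⟩ := exists_surjective_factor_of_pow hk hi (by omega) (m := 2)
    (c_sq_mem_γ_succ hk hi1)
  let e : (Fin (rk k i + 1) → C 2) ≃* C 2 × (Fin (rk k i) → C 2) :=
    { Fin.consEquiv (fun _ => C 2) |>.symm with map_mul' := fun _ _ => rfl }
  refine nonempty_mulEquiv_of_surjective (f := f.comp e.toMonoidHom) (hf.comp e.surjective) ?_
  rw [card_factor hk (by omega) (by omega), card_pi_C, expo, if_neg (by omega), if_pos hi2,
    if_neg (by omega)]
  congr 1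
  omega

theorem factor_equiv_tail (hk : 1 ≤ k) {i r : ℕ} (hi : 2 ^ k + 2 ^ (k - 1) < i)
    (hi2 : i ≤ 2 * 2 ^ k) (hr : r = rk k i) : Nonempty (factor k i ≃* (Fin r → C 2)) := by
  subst hr
  have h2 := two_pow_eq hk
  have h3 : 0 < 2 ^ (k - 1) := by positivity
  obtain ⟨f, hf⟩ := exists_surjective_factor_of_mem hk (by omega) hi2 (c_mem_γ_succ hk hi)
  refine nonempty_mulEquiv_of_surjective hf ?_
  rw [card_factor hk (by omega) (by omega), card_pi_C, expo, if_neg (by omega), if_neg (by omega),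
    if_neg (by omega)]
  congr 1
  omega

/-- The factor with index `2^(k+1) - 1` still has rank one; its generator is `c_{2^k, 2^k - 1}`. -/
theorem nilpotencyClass_G (hk : 1 ≤ k) : Group.nilpotencyClass (G k) = 2 ^ (k + 1) - 1 := by
  have h2 := two_pow_eq hk
  have h3 : 0 < 2 ^ (k - 1) := by positivity
  have h4 : 2 ^ (k + 1) = 2 * 2 ^ k := pow_succ' 2 k
  have := isNilpotent_G (k := k)
  refine le_antisymm ?_ ?_
  · rw [← Subgroup.lowerCentralSeries_eq_bot_iff_nilpotencyClass_le]
    exact γ_two_pow_succ hk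
  · by_contra hlt
    have h5 : (⊤ : Subgroup (G k)).lowerCentralSeries (2 ^ (k + 1) - 2) = ⊥ := by
      rw [Subgroup.lowerCentralSeries_eq_bot_iff_nilpotencyClass_le]
      omega
    have h6 : γ k (2 * 2 ^ k - 1) = ⊥ := by
      rw [← h5, γ, h4]
      congr 1
    have h7 := card_γ (k := k) (2 * 2 ^ k - 1)
    rw [h6, Subgroup.card_bot, card_factor hk (by omega) (by omega)] at h7
    have h8 : 1 ≤ expo k (2 * 2 ^ k - 1) := by
      rw [expo, rk, if_neg (by omega : ¬ 2 * 2 ^ k - 1 ≤ 2 ^ k)]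
      omega
    have h9 : 2 ^ 1 ≤ 2 ^ expo k (2 * 2 ^ k - 1) := Nat.pow_le_pow_right two_pos h8
    have h10 := Nat.eq_one_of_mul_eq_one_right h7.symm
    omega

/-! ### The lists of generators -/

/-- With `m` and `i` even, `n` is even, so `n ≥ 1` amounts to `n ≥ 2`. The bound `n ≤ 2^k - 1` is
automatic for `i ≤ 2^k`. -/
theorem ccGens_eq_of_even {i : ℕ} (hi : 2 ≤ i) (hi2 : i ≤ 2 ^ k) (he : Even i) :
    {g | ∃ m n : ℕ, Even m ∧ 2 ≤ m ∧ 2 ≤ n ∧ m + n = i ∧ g = cc k m n} = ccGens k (i - 2) := by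
  obtain ⟨l, rfl⟩ := he
  ext g
  constructor
  · rintro ⟨m, n, ⟨t, rfl⟩, hm, hn, hmn, rfl⟩
    refine ⟨t + t - 1, n - 1, ⟨t - 1, by omega⟩, by omega, by omega, by omega, ?_⟩
    congr 1 <;> omega
  · rintro ⟨a, j, ⟨t, rfl⟩, ha, hj, hd, rfl⟩
    exact ⟨2 * t + 1 + 1, j + 1, ⟨t + 1, by omega⟩, by omega, by omega, by omega, rfl⟩

theorem ccGens_eq_of_odd {i : ℕ} (hi : 2 ≤ i) (hi2 : i ≤ 2 ^ k) :
    {g | ∃ m n : ℕ, Even m ∧ 2 ≤ m ∧ 1 ≤ n ∧ m + n = i ∧ g = cc k m n} = ccGens k (i - 2) := by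
  ext g
  constructor
  · rintro ⟨m, n, ⟨t, rfl⟩, hm, hn, hmn, rfl⟩
    refine ⟨t + t - 1, n - 1, ⟨t - 1, by omega⟩, by omega, by omega, by omega, ?_⟩
    congr 1 <;> omega
  · rintro ⟨a, j, ⟨t, rfl⟩, ha, hj, hd, rfl⟩
    exact ⟨2 * t + 1 + 1, j + 1, ⟨t + 1, by omega⟩, by omega, by omega, by omega, rfl⟩

/-- Beyond `2^k` the bound `n ≤ 2^k - 1` is the effective one; by parity it sharpens to `n ≤ 2^k -
2` for even `i`. -/
theorem ccGens_eq_of_lt_even (hk : 1 ≤ k) {i : ℕ} (hi : 2 ^ k < i) (he : Even i) :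
    {g | ∃ m n : ℕ, Even m ∧ i + 2 ≤ m + 2 ^ k ∧ m ≤ 2 ^ k ∧ m + n = i ∧ g = cc k m n} =
      ccGens k (i - 2) := by
  have h2 := two_pow_eq hk
  obtain ⟨l, rfl⟩ := he
  ext g
  constructor
  · rintro ⟨m, n, ⟨t, rfl⟩, hm, hn, hmn, rfl⟩
    refine ⟨t + t - 1, n - 1, ⟨t - 1, by omega⟩, by omega, by omega, by omega, ?_⟩
    congr 1 <;> omega
  · rintro ⟨a, j, ⟨t, rfl⟩, ha, hj, hd, rfl⟩
    exact ⟨2 * t + 1 + 1, j + 1, ⟨t + 1, by omega⟩, by omega, by omega, by omega, rfl⟩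

theorem ccGens_eq_of_lt_odd (hk : 1 ≤ k) {i : ℕ} (hi : 2 ^ k < i) :
    {g | ∃ m n : ℕ, Even m ∧ i + 1 ≤ m + 2 ^ k ∧ m ≤ 2 ^ k ∧ m + n = i ∧ g = cc k m n} =
      ccGens k (i - 2) := by
  have h2 := two_pow_eq hk
  ext g
  constructor
  · rintro ⟨m, n, ⟨t, rfl⟩, hm, hn, hmn, rfl⟩
    refine ⟨t + t - 1, n - 1, ⟨t - 1, by omega⟩, by omega, by omega, by omega, ?_⟩
    congr 1 <;> omega
  · rintro ⟨a, j, ⟨t, rfl⟩, ha, hj, hd, rfl⟩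
    exact ⟨2 * t + 1 + 1, j + 1, ⟨t + 1, by omega⟩, by omega, by omega, by omega, rfl⟩

end Factors

end WreathCover

end

theorem mainTheorem3 (k : ℕ) (hk : 1 ≤ k) :
    -- the nilpotency class
    (Group.IsNilpotent (G k) ∧ Group.nilpotencyClass (G k) = 2 ^ (k + 1) - 1) ∧
    -- the first factor
    (γ k 1 = ⊤ ∧ γ k 1 = Subgroup.closure {x k, y k} ⊔ γ k 2 ∧
      Nonempty (factor k 1 ≃* C (2 ^ k) × C 4)) ∧
    -- the range `2 ≤ i ≤ 2 ^ k`
    (∀ i : ℕ, 2 ≤ i → i ≤ 2 ^ k →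
      (Even i → γ k i = Subgroup.closure
        ({c k i} ∪ {g | ∃ m n : ℕ, Even m ∧ 2 ≤ m ∧ 2 ≤ n ∧ m + n = i ∧ g = cc k m n})
          ⊔ γ k (i + 1)) ∧
      (Odd i → γ k i = Subgroup.closure
        ({c k i} ∪ {g | ∃ m n : ℕ, Even m ∧ 2 ≤ m ∧ 1 ≤ n ∧ m + n = i ∧ g = cc k m n})
          ⊔ γ k (i + 1)) ∧
      (i ≤ 2 ^ (k - 1) → Even i → Nonempty (factor k i ≃* C 4 × (Fin ((i - 2) / 2) → C 2))) ∧
      (i ≤ 2 ^ (k - 1) → Odd i → Nonempty (factor k i ≃* C 4 × (Fin ((i - 1) / 2) → C 2))) ∧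
      (2 ^ (k - 1) + 1 ≤ i → Even i → Nonempty (factor k i ≃* (Fin (i / 2) → C 2))) ∧
      (2 ^ (k - 1) + 1 ≤ i → Odd i → Nonempty (factor k i ≃* (Fin ((i + 1) / 2) → C 2)))) ∧
    -- the range `2 ^ k + 1 ≤ i ≤ 2 ^ k + 2 ^ (k - 1)`
    (∀ i : ℕ, 2 ^ k + 1 ≤ i → i ≤ 2 ^ k + 2 ^ (k - 1) →
      (Even i → γ k i = Subgroup.closure
        ({c k i} ∪
          {g | ∃ m n : ℕ, Even m ∧ i + 2 ≤ m + 2 ^ k ∧ m ≤ 2 ^ k ∧ m + n = i ∧ g = cc k m n})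
          ⊔ γ k (i + 1)) ∧
      (Odd i → γ k i = Subgroup.closure
        ({c k i} ∪
          {g | ∃ m n : ℕ, Even m ∧ i + 1 ≤ m + 2 ^ k ∧ m ≤ 2 ^ k ∧ m + n = i ∧ g = cc k m n})
          ⊔ γ k (i + 1)) ∧
      (Even i → Nonempty (factor k i ≃* (Fin ((2 ^ (k + 1) - i + 2) / 2) → C 2))) ∧
      (Odd i → Nonempty (factor k i ≃* (Fin ((2 ^ (k + 1) - i + 3) / 2) → C 2)))) ∧
    -- the range `2 ^ k + 2 ^ (k - 1) + 1 ≤ i ≤ 2 ^ (k + 1)`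
    (∀ i : ℕ, 2 ^ k + 2 ^ (k - 1) + 1 ≤ i → i ≤ 2 ^ (k + 1) →
      (Even i → γ k i = Subgroup.closure
        {g | ∃ m n : ℕ, Even m ∧ i + 2 ≤ m + 2 ^ k ∧ m ≤ 2 ^ k ∧ m + n = i ∧ g = cc k m n}
          ⊔ γ k (i + 1)) ∧
      (Odd i → γ k i = Subgroup.closure
        {g | ∃ m n : ℕ, Even m ∧ i + 1 ≤ m + 2 ^ k ∧ m ≤ 2 ^ k ∧ m + n = i ∧ g = cc k m n}
          ⊔ γ k (i + 1)) ∧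
      (Even i → Nonempty (factor k i ≃* (Fin ((2 ^ (k + 1) - i) / 2) → C 2))) ∧
      (Odd i → Nonempty (factor k i ≃* (Fin ((2 ^ (k + 1) - i + 1) / 2) → C 2)))) := by
  have h2 := two_pow_eq hk
  have h3 : 0 < 2 ^ (k - 1) := by positivity
  have h4 : 2 ^ (k + 1) = 2 * 2 ^ k := pow_succ' 2 k
  refine ⟨⟨isNilpotent_G, nilpotencyClass_G hk⟩, ⟨γ_one, ?_, factor_one_equiv hk⟩, ?_, ?_, ?_⟩
  · rw [closure_x_y, γ_one, top_sup_eq]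
  · intro i hi hi2
    refine ⟨fun he => ?_, fun ho => ?_, fun h he => ?_, fun h ho => ?_, fun h he => ?_,
      fun h ho => ?_⟩
    · rw [ccGens_eq_of_even hi hi2 he]
      exact γ_eq hi
    · rw [ccGens_eq_of_odd hi hi2]
      exact γ_eq hi
    · obtain ⟨l, rfl⟩ := he
      exact factor_equiv_four hk hi h (by rw [rk, if_pos (by omega)]; omega)
    · exact factor_equiv_four hk hi h (by rw [rk, if_pos (by omega)])
    · obtain ⟨l, rfl⟩ := he
      exact factor_equiv_two hk hi h (by omega) (by rw [rk, if_pos (by omega)]; omega)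
    · obtain ⟨l, rfl⟩ := ho
      exact factor_equiv_two hk hi h (by omega) (by rw [rk, if_pos (by omega)]; omega)
  · intro i hi hi2
    refine ⟨fun he => ?_, fun ho => ?_, fun he => ?_, fun ho => ?_⟩
    · rw [ccGens_eq_of_lt_even hk hi he]
      exact γ_eq (by omega)
    · rw [ccGens_eq_of_lt_odd hk hi]
      exact γ_eq (by omega)
    · obtain ⟨l, rfl⟩ := he
      exact factor_equiv_two hk (by omega) (by omega) hi2 (by rw [rk, if_neg (by omega)]; omega)
    · exact factor_equiv_two hk (by omega) (by omega) hi2 (by rw [rk, if_neg (by omega)]; omega)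
  · intro i hi hi2
    refine ⟨fun he => ?_, fun ho => ?_, fun he => ?_, fun ho => ?_⟩
    · rw [ccGens_eq_of_lt_even hk (by omega) he]
      exact γ_eq_of_c_mem (by omega) (c_mem_γ_succ hk hi)
    · rw [ccGens_eq_of_lt_odd hk (by omega)]
      exact γ_eq_of_c_mem (by omega) (c_mem_γ_succ hk hi)
    · obtain ⟨l, rfl⟩ := he
      exact factor_equiv_tail hk hi (by omega) (by rw [rk, if_neg (by omega)]; omega)
    · exact factor_equiv_tail hk hi (by omega) (by rw [rk, if_neg (by omega)]; omega)
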